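/- Let $n\ge 1$, $r\ge 1$, and let $\Gamma_n=\langle a,b\mid [a^n,b]=1\rangle$ be the group of the twisted Hopf link with $n$ twists. Let $X_r=\mathrm{Hom}(\Gamma_n,\mathrm U(r))/\mathrm U(r)$ be its $\mathrm U(r)$-character variety (the space of conjugacy classes of pairs $(A,B)\in \mathrm U(r)^2$ with $[A^n,B]=\mathrm{Id}$). Let $\sigma$ be a partition of $r$ with at least one part equal to $1$, let $m_1=1,m_2,\dots,m_N$ be an enumeration of its parts (with repetitions) that starts with such a part, and let $X_\sigma^*\subset X_r$ be the set of classes of irreducible $(A,B)$ such that the multiplicities of the distinct eigenvalues of $A$ are the parts of $\sigma$ (so $A$ has $N$ distinct eigenvalues, at least one of them simple). For $\lambda=(\lambda_1,\dots,\lambda_N)$ write $A_\lambda$ for the $r\times r$ diagonal matrix in which $\lambda_1,\dots,\lambda_N$ are repeated $m_1,\dots,m_N$ times. Let: * $\Sigma_\sigma$ be the set of $\lambda\in(S^1)^N$ with distinct entries and $\lambda_1^n=\dots=\lambda_N^n$; * $\mathrm{Stab}(\sigma)=\mathrm U(m_1)\times\dots\times \mathrm U(m_N)\subset \mathrm U(r)$,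 the stabiliser of $A_\lambda$ under conjugation for each $\lambda\in(S^1)^N$ with distinct entries; * $\mathbf F_\sigma$ be the quotient by conjugation by $\mathrm{Stab}(\sigma)$ of the set of $B\in\mathrm U(r)$ that have no proper nonzero invariant subspace in common with $A_\lambda$, for $\lambda$ with distinct entries (this does not depend on $\lambda$), and $\mathrm S\mathbf F_\sigma$ the corresponding quotient of the set of such $B$ with $\det B=1$; * $\Delta^{N-1}_{\boldsymbol\mu_n}$ be the set of tuples $(\epsilon_2,\dots,\epsilon_N)$ of distinct $n$-th roots of unity different from $1$; * $S_\sigma\le S_N$ be the group of the permutations $\tau$ with $m_{\tau(i)}=m_i$ for all $i$, a product of symmetric groups (it is $S_r$ if $\sigma=(1,\dots,1)$). Let $\tau\in S_\sigma$ act on $\Sigma_\sigma$ by permuting the entries, and on $\mathbf F_\sigma$ by $[B]\mapsto[P_\tau BP_\tau^{-1}]$, where $P_\tau$ is the permutation matrix that permutes the blocks of columns according to $\tau$. Identify $S^1\times\Delta^{N-1}_{\boldsymbol\mu_n}$ with $\Sigma_\sigma$ by $(\lambda,\epsilon)\mapsto(\lambda,\lambda\epsilon_2,\dots,\lambda\epsilon_N)$,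 and $\mathrm S\mathbf F_\sigma\times S^1$ with $\mathbf F_\sigma$ by $([B],\mu)\mapsto[B\,\mathrm{diag}(\mu,1,\dots,1)]$, and let $S_\sigma$ act on the former spaces through these identifications. Then $$X_\sigma^*\;\cong\;(\Sigma_\sigma\times\mathbf F_\sigma)/S_\sigma\;\cong\;\bigl(S^1\times\Delta^{N-1}_{\boldsymbol\mu_n}\times \mathrm S\mathbf F_\sigma\times S^1\bigr)/S_\sigma ,$$ where the isomorphisms are homeomorphisms onto $X_\sigma^*$, given by $[(\lambda,[B])]\mapsto[(A_\lambda,B)]$ and by $[(\lambda,\epsilon,[B],\mu)]\mapsto[(A_{(\lambda,\lambda\epsilon_2,\dots,\lambda\epsilon_N)},\,B\,\mathrm{diag}(\mu,1,\dots,1))]$. -/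

import Mathlib

noncomputable section

open Matrix

namespace HopfLink

/-! ### The link group, its unitary representations and the character variety -/

/-- The relator `[a ^ n, b] = a ^ n * b * (a ^ n)⁻¹ * b⁻¹`, where `a` and `b` are the generators `0` and `1`. -/
def linkRels (n : ℕ) : Set (FreeGroup (Fin 2)) :=
  {FreeGroup.of 0 ^ n * FreeGroup.of 1 * (FreeGroup.of 0 ^ n)⁻¹ * (FreeGroup.of 1)⁻¹}

/-- The group `Γ_n = ⟨a, b ∣ [a ^ n, b] = 1⟩` of the twisted Hopf link with `n` twists. -/
abbrev LinkGroup (n : ℕ) : Type := PresentedGroup (linkRels n)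

/-- The generator `a` of `Γ_n`. -/
def genA (n : ℕ) : LinkGroup n := PresentedGroup.of 0

/-- The generator `b` of `Γ_n`. -/
def genB (n : ℕ) : LinkGroup n := PresentedGroup.of 1

/-- The representation variety `Hom(Γ_n, U(r))`. -/
def Rep (n r : ℕ) : Type := LinkGroup n →* unitaryGroup (Fin r) ℂ

/-- The value of a representation at an element of the group. -/
def Rep.val {n r : ℕ} (ρ : Rep n r) (γ : LinkGroup n) : unitaryGroup (Fin r) ℂ :=
  (show LinkGroup n →* unitaryGroup (Fin r) ℂ from ρ) γ

/-- `Hom(Γ_n, U(r))` is topologised as a subspace of `U(r) × U(r)` through `ρ ↦ (ρ a, ρ b)`. -/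
instance (n r : ℕ) : TopologicalSpace (Rep n r) :=
  TopologicalSpace.induced (fun ρ => (ρ.val (genA n), ρ.val (genB n))) inferInstance

/-- The conjugation action `(g • ρ) γ = g * ρ γ * g⁻¹`. -/
instance (n r : ℕ) : MulAction (unitaryGroup (Fin r) ℂ) (Rep n r) where
  smul g ρ := (MulAut.conj g).toMonoidHom.comp ρ
  one_smul ρ := by
    refine MonoidHom.ext fun γ => ?_
    change (1 : unitaryGroup (Fin r) ℂ) * ρ.val γ * 1⁻¹ = ρ.val γ
    simp
  mul_smul g h ρ := by
    refine MonoidHom.ext fun γ => ?_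
    change g * h * ρ.val γ * (g * h)⁻¹ = g * (h * ρ.val γ * h⁻¹) * g⁻¹
    group

/-- The character variety `X_r = Hom(Γ_n, U(r)) / U(r)`: since `U(r)` is compact, all orbits are
closed and this is the space of orbits, with the quotient topology. -/
abbrev CharVar (n r : ℕ) : Type :=
  Quotient (MulAction.orbitRel (unitaryGroup (Fin r) ℂ) (Rep n r))

/-- A set of square matrices acts irreducibly: the only subspaces invariant under all of its
members are the trivial ones. -/
def ActsIrreducibly {ι : Type*} [Fintype ι] (S : Set (Matrix ι ι ℂ)) : Prop :=
  ∀ W : Submodule ℂ (ι → ℂ), (∀ M ∈ S, ∀ v ∈ W, M *ᵥ v ∈ W) → W = ⊥ ∨ W = ⊤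

/-- Irreducible representations. -/
def Rep.IsIrreducible {n r : ℕ} (ρ : Rep n r) : Prop :=
  ActsIrreducibly (Set.range fun γ : LinkGroup n => (ρ.val γ : Matrix (Fin r) (Fin r) ℂ))

/-- The multiset of the multiplicities of the distinct eigenvalues of a matrix. -/
def eigenMultiplicities {r : ℕ} (A : Matrix (Fin r) (Fin r) ℂ) : Multiset ℕ :=
  A.charpoly.roots.toFinset.val.map fun z => A.charpoly.roots.count z

/-- The stratum `X_σ^*`: the classes of the irreducible representations for which the eigenvalues
of the matrix of `a` have the multiplicities prescribed by the partition `σ`. It is a subspace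
of the character variety. -/
def Stratum (n : ℕ) {r : ℕ} (σ : r.Partition) : Set (CharVar n r) :=
  {x | ∃ ρ : Rep n r, (⟦ρ⟧ : CharVar n r) = x ∧ ρ.IsIrreducible ∧
    eigenMultiplicities (ρ.val (genA n) : Matrix (Fin r) (Fin r) ℂ) = σ.parts}

/-! ### Unitary matrices in block form -/

/-- Transport of unitary matrices along a bijection of the index sets; for a permutation `e` this
is `B ↦ P_e * B * P_e⁻¹`. -/
def ureindex {ι κ : Type*} [Fintype ι] [DecidableEq ι] [Fintype κ] [DecidableEq κ] (e : ι ≃ κ) :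
    unitaryGroup ι ℂ →* unitaryGroup κ ℂ where
  toFun B := ⟨reindex e e (B : Matrix ι ι ℂ), by
    rw [mem_unitaryGroup_iff, star_eq_conjTranspose, conjTranspose_reindex, reindex_apply,
      reindex_apply, submatrix_mul_equiv, ← star_eq_conjTranspose,
      mem_unitaryGroup_iff.1 B.2, submatrix_one_equiv]⟩
  map_one' := by
    apply Subtype.ext
    simp
  map_mul' B C := by
    apply Subtype.ext
    simp [submatrix_mul_equiv]

/-- The diagonal unitary matrix with given diagonal. -/
def udiag {ι : Type*} [Fintype ι] [DecidableEq ι] : (ι → Circle) →* unitaryGroup ι ℂ where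
  toFun d := ⟨diagonal fun x => (d x : ℂ), by
    rw [mem_unitaryGroup_iff, star_eq_conjTranspose, diagonal_conjTranspose, diagonal_mul_diagonal,
      ← diagonal_one]
    congr 1
    funext x
    simp [Complex.mul_conj]⟩
  map_one' := by
    apply Subtype.ext
    simp
  map_mul' c d := by
    apply Subtype.ext
    simp [diagonal_mul_diagonal]

variable {N : ℕ}

/-- The index set of the blocks of sizes `m 0, …, m (N - 1)`: a pair `⟨i, j⟩` is the `j`-th
position of the `i`-th block. -/
abbrev BlockIndex (m : Fin N → ℕ) : Type := (i : Fin N) × Fin (m i)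

/-- The numbering of the positions of the blocks in lexicographic order. -/
def blockEquiv (m : Fin N → ℕ) {r : ℕ} (h : ∑ i, m i = r) : BlockIndex m ≃ Fin r :=
  finSigmaFinEquiv.trans (finCongr h)

theorem sum_of_parts {r : ℕ} {σ : r.Partition} {m : Fin N → ℕ}
    (hm : σ.parts = Finset.univ.val.map m) : ∑ i, m i = r := by
  rw [← σ.parts_sum, hm]
  rfl

/-- Every partition with a part equal to `1` has an enumeration that starts with `1`. -/
theorem exists_enumeration {r : ℕ} (σ : r.Partition) (h : 1 ∈ σ.parts) :
    ∃ (k : ℕ) (m : Fin (k + 1) → ℕ), σ.parts = Finset.univ.val.map m ∧ m 0 = 1 := by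
  obtain ⟨t, ht⟩ := Multiset.exists_cons_of_mem h
  obtain ⟨l, rfl⟩ := Quot.exists_rep t
  refine ⟨l.length, (1 :: l).get, ?_, rfl⟩
  rw [ht, Fin.univ_val_map, List.ofFn_get]
  rfl

/-- The scalar-in-blocks diagonal matrix `diag(l 0, …, l 0, l 1, …, l 1, …)`, where `l i` is
repeated `m i` times. -/
def blockDiag (m : Fin N → ℕ) : (Fin N → Circle) →* unitaryGroup (BlockIndex m) ℂ where
  toFun l := udiag fun x => l x.1
  map_one' := map_one udiag
  map_mul' a b := map_mul udiag (fun x : BlockIndex m => a x.1) fun x => b x.1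

/-- `Stab(σ) = U(m 0) × ⋯ × U(m (N - 1))`: the unitary matrices in block diagonal form. They form
the stabiliser of `blockDiag m l` under conjugation for each tuple `l` with distinct entries. -/
def blockStab (m : Fin N → ℕ) : Subgroup (unitaryGroup (BlockIndex m) ℂ) where
  carrier := {g | ∀ x y : BlockIndex m, x.1 ≠ y.1 → g.1 x y = 0}
  one_mem' x y h := by
    have : x ≠ y := fun e => h (by rw [e])
    simp [this]
  mul_mem' {g h} hg hh x y hxy := by
    change (g.1 * h.1) x y = 0
    rw [mul_apply]
    refine Finset.sum_eq_zero fun z _ => ?_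
    by_cases hz : x.1 = z.1
    · rw [hh z y (hz ▸ hxy), mul_zero]
    · rw [hg x z hz, zero_mul]
  inv_mem' {g} hg x y hxy := by
    change (star g.1) x y = 0
    rw [star_apply, hg y x (Ne.symm hxy), star_zero]

/-- `F_σ^0`: the `B` in `U(r)` that have no proper nonzero invariant subspace in common with
`A = diag(l 0, …, l 0, l 1, …)`, where `l 0, l 1, …` are distinct. The subspaces invariant under
`A`, and hence the condition, do not depend on the choice of `l`. -/
def IsFibre (m : Fin N → ℕ) (B : unitaryGroup (BlockIndex m) ℂ) : Prop :=
  ∀ l : Fin N → Circle, Function.Injective l →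
    ActsIrreducibly {(blockDiag m l : Matrix (BlockIndex m) (BlockIndex m) ℂ), B.1}

theorem ActsIrreducibly.transport {ι κ : Type*} [Fintype ι] [Fintype κ]
    {S : Set (Matrix ι ι ℂ)} {T : Set (Matrix κ κ ℂ)} (hS : ActsIrreducibly S)
    (φ : (ι → ℂ) ≃ₗ[ℂ] (κ → ℂ)) (h : ∀ M ∈ S, ∃ M' ∈ T, ∀ v, φ (M *ᵥ v) = M' *ᵥ φ v) :
    ActsIrreducibly T := by
  intro W hW
  have h1 := hS (W.comap φ.toLinearMap) fun M hM v hv => by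
    obtain ⟨M', hM', e⟩ := h M hM
    change φ (M *ᵥ v) ∈ W
    rw [e]
    exact hW M' hM' _ hv
  have h2 : (W.comap φ.toLinearMap).map φ.toLinearMap = W :=
    Submodule.map_comap_eq_of_surjective φ.surjective W
  rcases h1 with h1 | h1
  · left; rw [← h2, h1, Submodule.map_bot]
  · right; rw [← h2, h1, Submodule.map_top]; exact LinearMap.range_eq_top.2 φ.surjective

/-- The action of a unitary matrix on vectors. -/
def unitaryEquiv {ι : Type*} [Fintype ι] [DecidableEq ι] (g : unitaryGroup ι ℂ) :
    (ι → ℂ) ≃ₗ[ℂ] (ι → ℂ) :=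
  LinearEquiv.ofLinearMap (mulVecLin g.1) (mulVecLin (g⁻¹).1)
    (by rw [← mulVecLin_mul, ← Submonoid.coe_mul, mul_inv_cancel]; simp)
    (by rw [← mulVecLin_mul, ← Submonoid.coe_mul, inv_mul_cancel]; simp)

theorem blockStab_comm {m : Fin N → ℕ} {g : unitaryGroup (BlockIndex m) ℂ} (hg : g ∈ blockStab m)
    (l : Fin N → Circle) : g * blockDiag m l = blockDiag m l * g := by
  apply Subtype.ext
  change g.1 * diagonal _ = diagonal _ * g.1
  ext x y
  rw [mul_diagonal, diagonal_mul]
  by_cases h : x.1 = y.1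
  · change g.1 x y * (l y.1 : ℂ) = l x.1 * g.1 x y
    rw [h, mul_comm]
  · rw [hg x y h]; simp

theorem IsFibre.conj {m : Fin N → ℕ} {B : unitaryGroup (BlockIndex m) ℂ} (hB : IsFibre m B)
    {g : unitaryGroup (BlockIndex m) ℂ} (hg : g ∈ blockStab m) : IsFibre m (g * B * g⁻¹) := by
  intro l hl
  refine (hB l hl).transport (unitaryEquiv g) ?_
  rintro M (rfl | rfl)
  · refine ⟨_, Or.inl rfl, fun v => ?_⟩
    change g.1 *ᵥ (blockDiag m l).1 *ᵥ v = (blockDiag m l).1 *ᵥ g.1 *ᵥ v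
    rw [mulVec_mulVec, mulVec_mulVec, ← Submonoid.coe_mul, ← Submonoid.coe_mul,
      blockStab_comm hg]
  · refine ⟨_, Or.inr rfl, fun v => ?_⟩
    change g.1 *ᵥ B.1 *ᵥ v = (g * B * g⁻¹).1 *ᵥ g.1 *ᵥ v
    rw [mulVec_mulVec, mulVec_mulVec, ← Submonoid.coe_mul, ← Submonoid.coe_mul,
      inv_mul_cancel_right]

theorem invariant_blockDiag {m : Fin N → ℕ} {l : Fin N → Circle} (hl : Function.Injective l)
    {W : Submodule ℂ (BlockIndex m → ℂ)} (hW : ∀ v ∈ W, (blockDiag m l).1 *ᵥ v ∈ W)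
    (f : Fin N → Circle) : ∀ v ∈ W, (blockDiag m f).1 *ᵥ v ∈ W := by
  intro v hv
  have hinj : Set.InjOn (fun i => (l i : ℂ)) (Finset.univ : Finset (Fin N)) :=
    fun i _ j _ h => hl (Circle.coe_injective h)
  let p := Lagrange.interpolate Finset.univ (fun i => (l i : ℂ)) fun i => (f i : ℂ)
  have hp : ∀ q : Polynomial ℂ, (fun x : BlockIndex m => q.eval (l x.1 : ℂ) * v x) ∈ W := by
    intro q
    induction q using Polynomial.induction_on' with
    | add a b ha hb =>
      convert W.add_mem ha hb using 1
      funext x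
      simp [add_mul]
    | monomial d c =>
      induction d generalizing c with
      | zero =>
        convert W.smul_mem c hv using 1
        funext x
        simp
      | succ d ih =>
        convert hW _ (ih c) using 1
        funext x
        change _ = (diagonal _ *ᵥ _) x
        rw [mulVec_diagonal]
        simp only [Polynomial.eval_monomial]
        ring
  convert hp p using 1
  funext x
  change (diagonal _ *ᵥ v) x = _
  rw [mulVec_diagonal, Lagrange.eval_interpolate_at_node _ hinj (Finset.mem_univ _)]

theorem IsFibre.mul_blockDiag {m : Fin N → ℕ} {B : unitaryGroup (BlockIndex m) ℂ}
    (hB : IsFibre m B) (f : Fin N → Circle) : IsFibre m (B * blockDiag m f) := by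
  intro l hl W hW
  have hA := hW _ (Or.inl rfl)
  refine hB l hl W ?_
  rintro M (rfl | rfl) v hv
  · exact hA v hv
  · have h1 := hW _ (Or.inr rfl) _ (invariant_blockDiag hl hA f⁻¹ v hv)
    rwa [mulVec_mulVec, ← Submonoid.coe_mul, mul_assoc, ← map_mul, mul_inv_cancel, map_one,
      mul_one] at h1

/-- `F_σ^0` as a subspace of `U(r)`. -/
def Fibre0 (m : Fin N → ℕ) : Type := {B : unitaryGroup (BlockIndex m) ℂ // IsFibre m B}

instance (m : Fin N → ℕ) : TopologicalSpace (Fibre0 m) :=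
  inferInstanceAs (TopologicalSpace {B : unitaryGroup (BlockIndex m) ℂ // IsFibre m B})

/-- The action of `Stab(σ)` on `F_σ^0` by conjugation. -/
instance (m : Fin N → ℕ) : MulAction (blockStab m) (Fibre0 m) where
  smul g B := ⟨g.1 * B.1 * g.1⁻¹, B.2.conj g.2⟩
  one_smul B := by
    apply Subtype.ext
    change (1 : unitaryGroup (BlockIndex m) ℂ) * B.1 * 1⁻¹ = B.1
    simp
  mul_smul g h B := by
    apply Subtype.ext
    change g.1 * h.1 * B.1 * (g.1 * h.1)⁻¹ = g.1 * (h.1 * B.1 * h.1⁻¹) * g.1⁻¹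
    group

/-- `F_σ = F_σ^0 / Stab(σ)`, a subspace of `U(r) / Stab(σ)`. -/
abbrev Fibre (m : Fin N → ℕ) : Type := Quotient (MulAction.orbitRel (blockStab m) (Fibre0 m))

/-- `SF_σ^0`: the elements of `F_σ^0` with determinant one. -/
def SFibre0 (m : Fin N → ℕ) : Type :=
  {B : unitaryGroup (BlockIndex m) ℂ // IsFibre m B ∧ B.1.det = 1}

instance (m : Fin N → ℕ) : TopologicalSpace (SFibre0 m) :=
  inferInstanceAs (TopologicalSpace
    {B : unitaryGroup (BlockIndex m) ℂ // IsFibre m B ∧ B.1.det = 1})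

theorem det_conj {m : Fin N → ℕ} (g B : unitaryGroup (BlockIndex m) ℂ)
    (h : B.1.det = 1) : (g * B * g⁻¹).1.det = 1 := by
  rw [Submonoid.coe_mul, Submonoid.coe_mul, det_mul, det_mul, h, mul_one, ← det_mul,
    ← Submonoid.coe_mul, mul_inv_cancel]
  simp

/-- The action of `Stab(σ)` on `SF_σ^0` by conjugation. -/
instance (m : Fin N → ℕ) : MulAction (blockStab m) (SFibre0 m) where
  smul g B := ⟨g.1 * B.1 * g.1⁻¹, B.2.1.conj g.2, det_conj g.1 B.1 B.2.2⟩
  one_smul B := by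
    apply Subtype.ext
    change (1 : unitaryGroup (BlockIndex m) ℂ) * B.1 * 1⁻¹ = B.1
    simp
  mul_smul g h B := by
    apply Subtype.ext
    change g.1 * h.1 * B.1 * (g.1 * h.1)⁻¹ = g.1 * (h.1 * B.1 * h.1⁻¹) * g.1⁻¹
    group

/-- `SF_σ = SF_σ^0 / Stab(σ)`. -/
abbrev SFibre (m : Fin N → ℕ) : Type := Quotient (MulAction.orbitRel (blockStab m) (SFibre0 m))

/-! ### The symmetric group of the type and its actions -/

/-- The permutations of the distinct eigenvalues that preserve multiplicities, a product of
symmetric groups. -/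
def multPerm (m : Fin N → ℕ) : Subgroup (Equiv.Perm (Fin N)) where
  carrier := {τ | ∀ i, m (τ i) = m i}
  one_mem' _ := rfl
  mul_mem' {s t} hs ht i := (hs (t i)).trans (ht i)
  inv_mem' {s} hs i := by
    have := hs (s⁻¹ i)
    rw [show s (s⁻¹ i) = i from s.apply_symm_apply i] at this
    exact this.symm

/-- The permutation of the coordinates that moves the `i`-th block to the place of the
`τ i`-th one and keeps the order inside the blocks. -/
def liftPerm (m : Fin N → ℕ) : multPerm m →* Equiv.Perm (BlockIndex m) where
  toFun τ :=
    { toFun := fun x => ⟨τ.1 x.1, Fin.cast (τ.2 x.1).symm x.2⟩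
      invFun := fun x => ⟨τ.1⁻¹ x.1, Fin.cast ((τ⁻¹).2 x.1).symm x.2⟩
      left_inv := fun ⟨i, j⟩ => by
        refine Sigma.ext (by simp) ?_
        exact (Fin.heq_ext_iff (by simp)).2 rfl
      right_inv := fun ⟨i, j⟩ => by
        refine Sigma.ext (by simp) ?_
        exact (Fin.heq_ext_iff (by simp)).2 rfl }
  map_one' := rfl
  map_mul' _ _ := rfl

/-- The simultaneous permutation of the blocks of rows and columns, `B ↦ P_τ * B * P_τ⁻¹`. -/
def permConj {m : Fin N → ℕ} (τ : multPerm m) :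
    unitaryGroup (BlockIndex m) ℂ →* unitaryGroup (BlockIndex m) ℂ :=
  ureindex (liftPerm m τ)

theorem permConj_one {m : Fin N → ℕ} (B : unitaryGroup (BlockIndex m) ℂ) :
    permConj (1 : multPerm m) B = B := rfl

theorem permConj_mul {m : Fin N → ℕ} (s t : multPerm m) (B : unitaryGroup (BlockIndex m) ℂ) :
    permConj (s * t) B = permConj s (permConj t B) := rfl

theorem permConj_det {m : Fin N → ℕ} (t : multPerm m) (B : unitaryGroup (BlockIndex m) ℂ) :
    (permConj t B).1.det = B.1.det :=
  det_reindex_self _ _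

theorem permConj_blockDiag {m : Fin N → ℕ} (t : multPerm m) (l : Fin N → Circle) :
    permConj t (blockDiag m l) = blockDiag m fun i => l (t.1⁻¹ i) := by
  apply Subtype.ext
  change reindex _ _ (diagonal _) = diagonal _
  rw [reindex_apply, submatrix_diagonal_equiv]
  rfl

theorem IsFibre.perm {m : Fin N → ℕ} {B : unitaryGroup (BlockIndex m) ℂ} (hB : IsFibre m B)
    (t : multPerm m) : IsFibre m (permConj t B) := by
  intro l hl
  have key : ∀ (C : unitaryGroup (BlockIndex m) ℂ) (v : BlockIndex m → ℂ),
      LinearEquiv.funCongrLeft ℂ ℂ (liftPerm m t).symm (C.1 *ᵥ v) =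
        (permConj t C).1 *ᵥ LinearEquiv.funCongrLeft ℂ ℂ (liftPerm m t).symm v := by
    intro C v
    change (C.1 *ᵥ v) ∘ (liftPerm m t).symm =
      (C.1.submatrix (liftPerm m t).symm (liftPerm m t).symm) *ᵥ (v ∘ (liftPerm m t).symm)
    rw [submatrix_mulVec_equiv]
    congr 2
    funext x
    simp
  refine (hB (fun i => l (t.1 i)) (hl.comp t.1.injective)).transport
    (LinearEquiv.funCongrLeft ℂ ℂ (liftPerm m t).symm) ?_
  rintro M (rfl | rfl)
  · refine ⟨_, Or.inl rfl, fun v => ?_⟩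
    rw [key, permConj_blockDiag]
    simp
  · exact ⟨_, Or.inr rfl, key B⟩

theorem permConj_stab {m : Fin N → ℕ} (t : multPerm m) {g : unitaryGroup (BlockIndex m) ℂ}
    (hg : g ∈ blockStab m) : permConj t g ∈ blockStab m := by
  intro x y hxy
  refine hg _ _ fun h => hxy ?_
  exact (t.1⁻¹).injective h

/-- The action on `F_σ`: the class of `B` goes to the class of `P_τ * B * P_τ⁻¹`. -/
instance (m : Fin N → ℕ) : MulAction (multPerm m) (Fibre m) where
  smul t := Quotient.map (fun B => ⟨permConj t B.1, B.2.perm t⟩) (by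
    rintro _ B ⟨g, rfl⟩
    refine ⟨⟨permConj t g.1, permConj_stab t g.2⟩, Subtype.ext ?_⟩
    change permConj t g.1 * permConj t B.1 * (permConj t g.1)⁻¹ = permConj t (g.1 * B.1 * g.1⁻¹)
    rw [map_mul, map_mul, map_inv])
  one_smul x := by
    induction x using Quotient.inductionOn
    rfl
  mul_smul s t x := by
    induction x using Quotient.inductionOn
    rfl

/-- `Σ_σ`: the tuples of distinct points of the unit circle with the same `n`-th power. -/
def EigenTuple (n N : ℕ) : Type :=
  {l : Fin N → Circle // Function.Injective l ∧ ∀ i j, l i ^ n = l j ^ n}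

instance (n N : ℕ) : TopologicalSpace (EigenTuple n N) :=
  inferInstanceAs (TopologicalSpace
    {l : Fin N → Circle // Function.Injective l ∧ ∀ i j, l i ^ n = l j ^ n})

/-- The action on eigenvalues by permutation. -/
instance (n : ℕ) (m : Fin N → ℕ) : MulAction (multPerm m) (EigenTuple n N) where
  smul t l := ⟨fun i => l.1 (t.1⁻¹ i), l.2.1.comp (t.1⁻¹).injective, fun _ _ => l.2.2 _ _⟩
  one_smul _ := rfl
  mul_smul _ _ _ := rfl

variable {k : ℕ}

/-- `Δ^k_{μ_n}`: the tuples of `k` distinct nontrivial `n`-th roots of unity. -/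
def RootTuple (n k : ℕ) : Type :=
  {ε : Fin k → Circle // (∀ i, ε i ^ n = 1 ∧ ε i ≠ 1) ∧ Function.Injective ε}

instance (n k : ℕ) : TopologicalSpace (RootTuple n k) :=
  inferInstanceAs (TopologicalSpace
    {ε : Fin k → Circle // (∀ i, ε i ^ n = 1 ∧ ε i ≠ 1) ∧ Function.Injective ε})

/-- The product `S¹ × Δ^k_{μ_n}`. -/
def EigenParam (n k : ℕ) : Type := Circle × RootTuple n k

instance (n k : ℕ) : TopologicalSpace (EigenParam n k) :=
  inferInstanceAs (TopologicalSpace (Circle × RootTuple n k))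

/-- The tuple `(1, ε 0, …, ε (k - 1))`. -/
def RootTuple.full {n : ℕ} (ε : RootTuple n k) : Fin (k + 1) → Circle := Fin.cons 1 ε.1

theorem RootTuple.full_injective {n : ℕ} (ε : RootTuple n k) : Function.Injective ε.full :=
  Fin.cons_injective_iff.2 ⟨fun ⟨i, hi⟩ => (ε.2.1 i).2 hi, ε.2.2⟩

theorem RootTuple.full_pow {n : ℕ} (ε : RootTuple n k) (i : Fin (k + 1)) : ε.full i ^ n = 1 := by
  refine Fin.cases ?_ (fun j => ?_) i
  · exact one_pow n
  · exact (ε.2.1 j).1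

/-- The tuple of eigenvalues `(z, z * ε 0, …, z * ε (k - 1))`. -/
def EigenParam.tuple {n : ℕ} (p : EigenParam n k) : Fin (k + 1) → Circle :=
  fun i => p.1 * p.2.full i

theorem EigenParam.tuple_inj {n : ℕ} {p q : EigenParam n k} (h : p.tuple = q.tuple) : p = q := by
  have h0 : p.1 = q.1 := by
    have : p.1 * 1 = q.1 * 1 := congrFun h 0
    simpa using this
  refine Prod.ext h0 (Subtype.ext (funext fun i => ?_))
  have : p.1 * p.2.1 i = q.1 * q.2.1 i := congrFun h i.succ
  rw [h0] at this
  exact mul_left_cancel this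

/-- The parameters of the permuted tuple of eigenvalues. -/
def EigenParam.perm {n : ℕ} (t : Equiv.Perm (Fin (k + 1))) (p : EigenParam n k) :
    EigenParam n k :=
  (p.1 * p.2.full (t⁻¹ 0), ⟨fun i => p.2.full (t⁻¹ i.succ) / p.2.full (t⁻¹ 0),
    fun i => ⟨by rw [div_pow, p.2.full_pow, p.2.full_pow, div_one], fun h =>
      Fin.succ_ne_zero i ((t⁻¹).injective (p.2.full_injective (div_eq_one.1 h)))⟩,
    fun _ _ h => Fin.succ_injective _ ((t⁻¹).injective (p.2.full_injective (div_left_injective h)))⟩)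

theorem EigenParam.perm_tuple {n : ℕ} (t : Equiv.Perm (Fin (k + 1))) (p : EigenParam n k) :
    (p.perm t).tuple = fun i => p.tuple (t⁻¹ i) := by
  funext i
  refine Fin.cases ?_ (fun j => ?_) i
  · change p.1 * p.2.full (t⁻¹ 0) * 1 = _
    rw [mul_one]
    rfl
  · change p.1 * p.2.full (t⁻¹ 0) * (p.2.full (t⁻¹ j.succ) / p.2.full (t⁻¹ 0)) = _
    rw [mul_assoc, mul_div_cancel]
    rfl

/-- The action on `S¹ × Δ^k_{μ_n}` by permutation of the eigenvalues
`(z, z * ε 0, …, z * ε (k - 1))`. -/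
instance (n : ℕ) (m : Fin (k + 1) → ℕ) : MulAction (multPerm m) (EigenParam n k) where
  smul t p := p.perm t.1
  one_smul p := EigenParam.tuple_inj (EigenParam.perm_tuple 1 p)
  mul_smul s t p := EigenParam.tuple_inj (by
    change (p.perm (s.1 * t.1)).tuple = ((p.perm t.1).perm s.1).tuple
    rw [EigenParam.perm_tuple, EigenParam.perm_tuple, EigenParam.perm_tuple]
    rfl)

/-- The diagonal matrix with entry `u` in the positions of the first block and `1` elsewhere.
Multiplying by it on the right multiplies the columns of the first block by `u`. -/
def firstScale (m : Fin (k + 1) → ℕ) (u : Circle) : unitaryGroup (BlockIndex m) ℂ :=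
  blockDiag m fun i => if i = 0 then u else 1

theorem blockDiag_inv {m : Fin N → ℕ} (f : Fin N → Circle) :
    (blockDiag m f)⁻¹ = blockDiag m f⁻¹ := (map_inv _ _).symm

/-- The matrix obtained from `B` by multiplying its first column by `u`, permuting the blocks of
rows and columns, and multiplying the first column by `u⁻¹`. -/
def SFibre0.perm {m : Fin (k + 1) → ℕ} (t : multPerm m) (u : Circle) (B : SFibre0 m) :
    SFibre0 m :=
  ⟨permConj t (B.1 * firstScale m u) * (firstScale m u)⁻¹, by
    refine ⟨?_, ?_⟩
    · rw [firstScale, blockDiag_inv]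
      exact ((B.2.1.mul_blockDiag _).perm t).mul_blockDiag _
    · rw [Submonoid.coe_mul, det_mul, permConj_det, Submonoid.coe_mul, det_mul, B.2.2, one_mul,
        ← det_mul, ← Submonoid.coe_mul, mul_inv_cancel]
      simp⟩

/-- The product `SF_σ × S¹`. -/
def FibreParam (m : Fin N → ℕ) : Type := SFibre m × Circle

instance (m : Fin N → ℕ) : TopologicalSpace (FibreParam m) :=
  inferInstanceAs (TopologicalSpace (SFibre m × Circle))

/-- The action on `SF_σ × S¹`. A pair `([B], u)` stands for the class in `F_σ` of the matrix
`B * firstScale m u`, of determinant `u` if the first block has size one; this class goes to that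
of `P_τ * (B * firstScale m u) * P_τ⁻¹`. -/
instance (m : Fin (k + 1) → ℕ) : MulAction (multPerm m) (FibreParam m) where
  smul t x := (Quotient.map (SFibre0.perm t x.2) (by
    rintro _ B ⟨g, rfl⟩
    refine ⟨⟨permConj t g.1, permConj_stab t g.2⟩, Subtype.ext ?_⟩
    change permConj t g.1 * (permConj t (B.1 * firstScale m x.2) * (firstScale m x.2)⁻¹) *
      (permConj t g.1)⁻¹ = permConj t (g.1 * B.1 * g.1⁻¹ * firstScale m x.2) * (firstScale m x.2)⁻¹
    have h1 : g.1⁻¹ * firstScale m x.2 = firstScale m x.2 * g.1⁻¹ :=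
      blockStab_comm (inv_mem g.2) _
    have h2 : (firstScale m x.2)⁻¹ * (permConj t g.1)⁻¹ =
        (permConj t g.1)⁻¹ * (firstScale m x.2)⁻¹ := by
      rw [firstScale, blockDiag_inv]
      exact (blockStab_comm (inv_mem (permConj_stab t g.2)) _).symm
    rw [mul_assoc (g.1 * B.1), h1, mul_assoc, mul_assoc (permConj t (B.1 * _)), h2]
    simp only [map_mul, map_inv, mul_assoc]) x.1, x.2)
  one_smul x := by
    obtain ⟨x, u⟩ := x
    induction x using Quotient.inductionOn with | _ B => ?_
    refine Prod.ext (congrArg (Quotient.mk _) (Subtype.ext ?_)) rfl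
    change B.1 * firstScale m u * (firstScale m u)⁻¹ = B.1
    rw [mul_inv_cancel_right]
  mul_smul s t x := by
    obtain ⟨x, u⟩ := x
    induction x using Quotient.inductionOn with | _ B => ?_
    refine Prod.ext (congrArg (Quotient.mk _) (Subtype.ext ?_)) rfl
    change permConj s (permConj t (B.1 * firstScale m u)) * (firstScale m u)⁻¹ =
      permConj s (permConj t (B.1 * firstScale m u) * (firstScale m u)⁻¹ * firstScale m u) *
        (firstScale m u)⁻¹
    rw [inv_mul_cancel_right]

/-- `(Σ_σ × F_σ) / S_σ`, for the diagonal action. -/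
abbrev EigenFibreQuotient (n : ℕ) (m : Fin N → ℕ) : Type :=
  Quotient (MulAction.orbitRel (multPerm m) (EigenTuple n N × Fibre m))

/-- `((S¹ × Δ^k_{μ_n}) × (SF_σ × S¹)) / S_σ`, for the diagonal action. -/
abbrev ParamQuotient (n : ℕ) (m : Fin (k + 1) → ℕ) : Type :=
  Quotient (MulAction.orbitRel (multPerm m) (EigenParam n k × FibreParam m))

end HopfLink

end

/-!
A class in the stratum is represented by a pair in block form, `(A_l, B)` with `l` in `Σ_σ` and `B`
in `F_σ^0`. Indeed, the matrix of `a` is unitarily diagonalisable (`exists_conj_udiag`), the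
multiplicities of its eigenvalues allow a numbering of the diagonal entries by the blocks
(`exists_conj_blockDiag`), and by Schur's lemma the central element `a ^ n` acts as a scalar
(`pow_eq_pow_of_actsIrreducibly`). Two such pairs are conjugate exactly when they differ by a
permutation of the blocks and an element of `Stab(σ)`, since the eigenvalues are conjugation
invariants and the centraliser of `A_l` is `Stab(σ)` (`mk_modelRep_eq_iff_exists_perm`). Hence
`(l, B) ↦ [(A_l, B)]` has the same fibres as the projection of `Σ_σ × F_σ^0` to
`(Σ_σ × F_σ) / S_σ`.

The inverse of the resulting bijection is continuous because both maps are quotient maps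
(`Topology.IsQuotientMap.exists_homeomorph`). For the projection this holds since the quotient maps
of group actions are open. For the parametrisation of the stratum it follows from compactness: on
the compact space `Σ_σ × U(r)` the map to the character variety is closed
(`isClosedMap_mk_modelRep`), and `Σ_σ × F_σ^0` is the full preimage of the stratum
(`isQuotientMap_modelClass`).

The second homeomorphism comes from the first by the change of coordinates
`(z, ε) ↦ (z, z ε_2, …, z ε_N)` on `Σ_σ` and, as the first block has size one,
`(B, u) ↦ B diag(u, 1, …, 1)` on `F_σ^0`, whose inverse reads off `u` as the determinant
(`eigenParamHomeomorph`, `fibreParamHomeomorph`). The actions of `S_σ` correspond to each other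
(`paramMk_eq_iff_eigenFibreMk`).
-/

noncomputable section

open Matrix

namespace HopfLink

/-! ### Diagonalisation of unitary matrices and change of index sets -/

/-- Two families with the same multiset of values differ by a bijection of the index sets. -/
theorem exists_equiv_of_map_univ_eq {α β γ : Type*} [Fintype α] [Fintype β] {f : α → γ}
    {g : β → γ} (h : Finset.univ.val.map f = Finset.univ.val.map g) :
    ∃ e : α ≃ β, ∀ a, g (e a) = f a := by
  classical
  have hcard : ∀ c, Fintype.card {a // f a = c} = Fintype.card {b // g b = c} := fun c => by
    have h1 := congrArg (Multiset.count c) h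
    rw [Multiset.count_map, Multiset.count_map] at h1
    rw [Fintype.card_subtype, Fintype.card_subtype]
    simp only [eq_comm (b := c)]
    exact h1
  exact ⟨Equiv.ofFiberEquiv fun c => Fintype.equivOfCardEq (hcard c),
    Equiv.ofFiberEquiv_map _⟩

section Unitary

variable {ι : Type*} [Fintype ι] [DecidableEq ι]

/-- The unit circle is infinite, so one of its points is not an eigenvalue. -/
theorem exists_circle_isUnit_sub (A : Matrix ι ι ℂ) :
    ∃ z : Circle, IsUnit (A - scalar ι (z : ℂ)).det := by
  have hinf : (Set.range fun n : ℕ => (Circle.exp (n : ℝ) : ℂ)).Infinite := by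
    refine Set.infinite_range_of_injective (Circle.coe_injective.comp fun a b hab => ?_)
    -- A coincidence between the points `exp (i n)` would make `π` rational.
    obtain ⟨k, hk⟩ := Circle.exp_eq_exp.1 hab
    by_contra hne
    have hk0 : k ≠ 0 := by
      rintro rfl
      apply hne
      simpa using hk
    apply irrational_pi.ne_rat (((a : ℚ) - b) / (2 * k))
    have : (k : ℝ) ≠ 0 := by exact_mod_cast hk0
    push_cast
    field_simp
    linarith
  obtain ⟨_, ⟨j, rfl⟩, hz⟩ := hinf.exists_notMem_finset A.charpoly.roots.toFinset
  refine ⟨Circle.exp j, ?_⟩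
  rw [isUnit_iff_ne_zero]
  intro h
  apply hz
  rw [Multiset.mem_toFinset, Polynomial.mem_roots A.charpoly_monic.ne_zero, Polynomial.IsRoot,
    eval_charpoly, ← neg_sub, det_neg, h, mul_zero]

/-- The spectral theorem for unitary matrices, deduced from the Hermitian one by the Cayley
transform `H = i (A + z) (A - z)⁻¹`, where `z` on the circle is not an eigenvalue of `A`. -/
theorem exists_conj_udiag (A : unitaryGroup ι ℂ) :
    ∃ (g : unitaryGroup ι ℂ) (d : ι → Circle), A = g * udiag d * g⁻¹ := by
  obtain ⟨z, hz⟩ := exists_circle_isUnit_sub A.1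
  set C : Matrix ι ι ℂ := A.1 - scalar ι (z : ℂ) with hC
  set K : Matrix ι ι ℂ := Cᴴ * (Complex.I • (A.1 + scalar ι (z : ℂ))) with hK
  have hA : A.1ᴴ * A.1 = 1 := mem_unitaryGroup_iff'.1 A.2
  have hzz : (starRingEnd ℂ) (z : ℂ) * z = 1 := by rw [mul_comm, Complex.mul_conj]; simp
  -- `H = (C⁻¹)ᴴ * K * C⁻¹` is the Cayley transform, so it is enough that `K` is Hermitian.
  have hKH : K.IsHermitian := by
    have hsc : ((scalar ι (z : ℂ))ᴴ : Matrix ι ι ℂ) = scalar ι ((starRingEnd ℂ) (z : ℂ)) := by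
      simp [scalar_apply, diagonal_conjTranspose]
    have : K = Complex.I • ((z : ℂ) • A.1ᴴ - (starRingEnd ℂ) (z : ℂ) • A.1) := by
      rw [hK, hC, conjTranspose_sub, hsc, mul_smul_comm, sub_mul, mul_add, mul_add, hA]
      congr 1
      rw [← map_mul, hzz, map_one]
      simp only [scalar_apply, ← smul_eq_diagonal_mul, ← smul_eq_mul_diagonal]
      abel
    rw [IsHermitian, this]
    simp only [conjTranspose_smul, conjTranspose_sub, conjTranspose_conjTranspose, 
      Complex.star_def, Complex.conj_I, Complex.conj_conj]
    module
  set H : Matrix ι ι ℂ := (C⁻¹)ᴴ * K * C⁻¹ with hH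
  have hHH : H.IsHermitian := isHermitian_conjTranspose_mul_mul _ hKH
  have hHC : H * C = Complex.I • (A.1 + scalar ι (z : ℂ)) := by
    rw [hH, hK, mul_assoc, nonsing_inv_mul _ hz, mul_one, ← mul_assoc, ← conjTranspose_mul,
      mul_nonsing_inv _ hz, conjTranspose_one, one_mul]
  set U := hHH.eigenvectorUnitary
  set D : Matrix ι ι ℂ := star U.1 * A.1 * U.1 with hD
  have hU : star U.1 * U.1 = 1 := mem_unitaryGroup_iff'.1 U.2
  have hU' : U.1 * star U.1 = 1 := mem_unitaryGroup_iff.1 U.2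
  have hspec : star U.1 * H = diagonal (fun x => (hHH.eigenvalues x : ℂ)) * star U.1 := by
    have h := hHH.conjStarAlgAut_star_eigenvectorUnitary
    rw [Unitary.conjStarAlgAut_star_apply] at h
    rw [show star U.1 * H = star U.1 * H * U.1 * star U.1 by rw [mul_assoc _ U.1, hU', mul_one]]
    congr 1
  -- In an eigenbasis of `H`, `(e x - i) * D x y = 0` for `x ≠ y`, where `e x` is real.
  have hdiag : ∀ x y, x ≠ y → D x y = 0 := by
    intro x y hxy
    have h1 : diagonal (fun x => (hHH.eigenvalues x : ℂ)) * (D - scalar ι (z : ℂ)) =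
        Complex.I • (D + scalar ι (z : ℂ)) := by
      have hs : ∀ w : ℂ, scalar ι w = star U.1 * scalar ι w * U.1 := fun w => by
        rw [mul_assoc, (scalar_commute w (fun _ => Commute.all _ _) U.1).eq, ← mul_assoc, hU,
          one_mul]
      rw [hs, hD, ← sub_mul, ← mul_sub, ← add_mul, ← mul_add, ← hC, ← mul_assoc, ← mul_assoc,
        ← hspec, mul_assoc (star U.1) H C, hHC, mul_smul_comm, smul_mul_assoc]
    have h2 := congrFun (congrFun h1 x) y
    rw [diagonal_mul] at h2
    rw [scalar_apply, Matrix.sub_apply, Matrix.smul_apply, Matrix.add_apply,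
      diagonal_apply_ne _ hxy, sub_zero, add_zero, smul_eq_mul] at h2
    rw [← sub_eq_zero, ← sub_mul] at h2
    refine (mul_eq_zero.1 h2).resolve_left fun h => ?_
    simpa using congrArg Complex.im h
  have hDU : D ∈ unitaryGroup ι ℂ := (star U * A * U).2
  have hDd : D = diagonal fun x => D x x := by
    ext x y
    by_cases h : x = y
    · rw [h, diagonal_apply_eq]
    · rw [diagonal_apply_ne _ h, hdiag x y h]
  have hnorm : ∀ x, ‖D x x‖ = 1 := by
    intro x
    have h1 := mem_unitaryGroup_iff.1 hDU
    rw [hDd, star_eq_conjTranspose, diagonal_conjTranspose, diagonal_mul_diagonal] at h1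
    have h2 := congrFun (congrFun h1 x) x
    rw [diagonal_apply_eq, one_apply_eq, Pi.star_apply, Complex.star_def, Complex.mul_conj,
      Complex.normSq_eq_norm_sq] at h2
    have h3 : ‖D x x‖ ^ 2 = 1 := by exact_mod_cast h2
    exact (pow_eq_one_iff_of_nonneg (norm_nonneg _) two_ne_zero).1 h3
  refine ⟨U, fun x => ⟨D x x, mem_sphere_zero_iff_norm.2 (hnorm x)⟩, Subtype.ext ?_⟩
  change A.1 = U.1 * (diagonal fun x => D x x) * star U.1
  rw [← hDd, hD]
  simp only [mul_assoc]
  rw [hU', mul_one, ← mul_assoc, hU', one_mul]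

/-- Reindexing along a permutation is conjugation by its permutation matrix. -/
theorem exists_conj_ureindex (e : Equiv.Perm ι) :
    ∃ P : unitaryGroup ι ℂ, ∀ B, P * B * P⁻¹ = ureindex e B := by
  refine ⟨⟨(1 : Matrix ι ι ℂ).submatrix e.symm id, ?_⟩, fun B => Subtype.ext ?_⟩
  · rw [mem_unitaryGroup_iff, star_eq_conjTranspose, conjTranspose_submatrix, conjTranspose_one,
      ← submatrix_mul _ _ _ _ _ Function.bijective_id, mul_one, submatrix_one_equiv]
  · change (1 : Matrix ι ι ℂ).submatrix e.symm id * B.1 *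
      star ((1 : Matrix ι ι ℂ).submatrix e.symm id) = B.1.submatrix e.symm e.symm
    rw [star_eq_conjTranspose, conjTranspose_submatrix, conjTranspose_one]
    ext x y
    simp [mul_apply, one_apply]

theorem charpoly_conj (g A : unitaryGroup ι ℂ) : (g * A * g⁻¹).1.charpoly = A.1.charpoly := by
  rw [Submonoid.coe_mul, charpoly_mul_comm, ← Submonoid.coe_mul, inv_mul_cancel_left]

theorem charpoly_ureindex {κ : Type*} [Fintype κ] [DecidableEq κ] (e : ι ≃ κ)
    (A : unitaryGroup ι ℂ) : (ureindex e A).1.charpoly = A.1.charpoly :=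
  charpoly_reindex e A.1

theorem roots_charpoly_udiag (d : ι → Circle) :
    (udiag d).1.charpoly.roots = Finset.univ.val.map fun x => (d x : ℂ) := by
  change (diagonal _).charpoly.roots = _
  rw [charpoly_diagonal, ← Polynomial.roots_multiset_prod_X_sub_C
    (Finset.univ.val.map fun x => (d x : ℂ)), Multiset.map_map]
  rfl

theorem count_roots_charpoly_udiag (d : ι → Circle) (z : ℂ) :
    (udiag d).1.charpoly.roots.count z = Fintype.card {x // (d x : ℂ) = z} := by
  rw [roots_charpoly_udiag, Multiset.count_map, Fintype.card_subtype]
  simp only [eq_comm]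
  rfl

end Unitary

/-! ### Multiplicities of eigenvalues -/

section Multiplicities

variable {N : ℕ} {m : Fin N → ℕ}

theorem roots_charpoly_blockDiag (l : Fin N → Circle) (z : ℂ) :
    z ∈ (blockDiag m l).1.charpoly.roots ↔ ∃ i, 0 < m i ∧ (l i : ℂ) = z := by
  change z ∈ (udiag _).1.charpoly.roots ↔ _
  rw [roots_charpoly_udiag]
  simp only [Multiset.mem_map, Finset.mem_val, Finset.mem_univ, true_and]
  constructor
  · rintro ⟨x, hx⟩
    exact ⟨x.1, x.2.pos, hx⟩
  · rintro ⟨i, hi, hx⟩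
    exact ⟨⟨i, ⟨0, hi⟩⟩, hx⟩

theorem count_roots_charpoly_blockDiag {l : Fin N → Circle} (hl : Function.Injective l)
    (i : Fin N) : (blockDiag m l).1.charpoly.roots.count (l i : ℂ) = m i := by
  change (udiag _).1.charpoly.roots.count (l i : ℂ) = _
  rw [count_roots_charpoly_udiag, ← Fintype.card_fin (m i)]
  refine Fintype.card_congr ((Equiv.subtypeEquivRight fun x => ?_).trans (Equiv.sigmaSubtype i))
  exact ⟨fun h => hl (Circle.coe_injective h), fun h => by rw [h]⟩

theorem eigenMultiplicities_eq {r : ℕ} {l : Fin N → Circle} (hl : Function.Injective l)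
    (hm : ∀ i, 0 < m i) {A : Matrix (Fin r) (Fin r) ℂ}
    (hA : A.charpoly = (blockDiag m l).1.charpoly) :
    eigenMultiplicities A = Finset.univ.val.map m := by
  have hF : A.charpoly.roots.toFinset =
      Finset.univ.map ⟨fun i => (l i : ℂ), Circle.coe_injective.comp hl⟩ := by
    ext z
    rw [Multiset.mem_toFinset, hA, roots_charpoly_blockDiag]
    simp [hm]
  rw [eigenMultiplicities, hF, Finset.map_val, Multiset.map_map]
  refine Multiset.map_congr rfl fun i _ => ?_
  rw [hA]
  exact count_roots_charpoly_blockDiag hl i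

/-- A unitary matrix whose eigenvalues have the multiplicities `m` is unitarily conjugate to a
matrix in block form. -/
theorem exists_conj_blockDiag {r : ℕ} (h : ∑ i, m i = r) (A : unitaryGroup (Fin r) ℂ)
    (hA : eigenMultiplicities A.1 = Finset.univ.val.map m) :
    ∃ (g : unitaryGroup (Fin r) ℂ) (l : Fin N → Circle), Function.Injective l ∧
      A = g * ureindex (blockEquiv m h) (blockDiag m l) * g⁻¹ := by
  obtain ⟨g, d, rfl⟩ := exists_conj_udiag A
  rw [eigenMultiplicities, charpoly_conj] at hA
  set R := (udiag d).1.charpoly.roots with hR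
  have hmemR : ∀ z, z ∈ R ↔ ∃ x, (d x : ℂ) = z := fun z => by
    rw [hR, roots_charpoly_udiag]
    simp
  -- The distinct eigenvalues, enumerated so that the multiplicities come out in the right order.
  obtain ⟨e, he⟩ : ∃ e : Fin N ≃ R.toFinset, ∀ i, R.count (e i : ℂ) = m i := by
    refine exists_equiv_of_map_univ_eq (g := fun z : R.toFinset => R.count (z : ℂ)) ?_
    rw [← hA]
    exact (Multiset.attach_map_val' R.toFinset.val fun z => R.count z).symm
  have hl : ∀ i, ∃ w : Circle, (w : ℂ) = e i := fun i => by
    obtain ⟨x, hx⟩ := (hmemR _).1 (Multiset.mem_toFinset.1 (e i).2)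
    exact ⟨d x, hx⟩
  choose l hl using hl
  have hlinj : Function.Injective l := fun i j hij =>
    e.injective (Subtype.ext (by rw [← hl, ← hl, hij]))
  let f : Fin r → Fin N := fun x => e.symm ⟨d x, Multiset.mem_toFinset.2 ((hmemR _).2 ⟨x, rfl⟩)⟩
  have hf : ∀ x, l (f x) = d x := fun x => Circle.coe_injective (by simp [hl, f])
  have hfib : ∀ i, Nonempty ({x // f x = i} ≃ Fin (m i)) := fun i => by
    have h1 := (count_roots_charpoly_udiag d (e i)).symm.trans (he i)
    refine ⟨(Equiv.subtypeEquivRight fun x => ?_).trans (Fintype.equivFinOfCardEq h1)⟩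
    rw [← hl, ← hf, Circle.coe_inj, hlinj.eq_iff]
  let E : Fin r ≃ BlockIndex m :=
    (Equiv.sigmaFiberEquiv f).symm.trans (Equiv.sigmaCongrRight fun i => (hfib i).some)
  have hE : ∀ x, (E x).1 = f x := fun _ => rfl
  obtain ⟨P, hP⟩ := exists_conj_ureindex (E.trans (blockEquiv m h))
  refine ⟨g * P⁻¹, l, hlinj, ?_⟩
  have h2 : ureindex (blockEquiv m h) (blockDiag m l) = P * udiag d * P⁻¹ := by
    rw [hP]
    apply Subtype.ext
    change reindex _ _ (diagonal _) = reindex _ _ (diagonal _)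
    rw [reindex_apply, reindex_apply, submatrix_diagonal_equiv, submatrix_diagonal_equiv]
    congr 1
    funext y
    simp [← hf, ← hE]
  rw [h2]
  group

end Multiplicities

/-! ### Representations of the link group -/

section Representations

variable {n r : ℕ}

/-- The representation of `Γ_n` with prescribed values at the generators. -/
def repOfPair (A B : unitaryGroup (Fin r) ℂ) (h : Commute (A ^ n) B) : Rep n r :=
  PresentedGroup.toGroup (f := ![A, B]) (by
    rintro _ rfl
    simp only [map_mul, map_pow, map_inv, FreeGroup.lift_apply_of]
    change A ^ n * B * (A ^ n)⁻¹ * B⁻¹ = 1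
    rw [h.eq]
    group)

theorem repOfPair_genA (A B : unitaryGroup (Fin r) ℂ) (h : Commute (A ^ n) B) :
    (repOfPair A B h).val (genA n) = A :=
  PresentedGroup.toGroup.of _

theorem repOfPair_genB (A B : unitaryGroup (Fin r) ℂ) (h : Commute (A ^ n) B) :
    (repOfPair A B h).val (genB n) = B :=
  PresentedGroup.toGroup.of _

theorem Rep.ext_gen {ρ ρ' : Rep n r} (hA : ρ.val (genA n) = ρ'.val (genA n))
    (hB : ρ.val (genB n) = ρ'.val (genB n)) : ρ = ρ' := by
  refine PresentedGroup.ext fun i => ?_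
  fin_cases i
  · exact hA
  · exact hB

theorem Rep.val_one (ρ : Rep n r) : ρ.val 1 = 1 := map_one _

theorem Rep.val_mul (ρ : Rep n r) (x y : LinkGroup n) : ρ.val (x * y) = ρ.val x * ρ.val y :=
  map_mul (show LinkGroup n →* unitaryGroup (Fin r) ℂ from ρ) x y

theorem Rep.val_inv (ρ : Rep n r) (x : LinkGroup n) : ρ.val x⁻¹ = (ρ.val x)⁻¹ :=
  map_inv (show LinkGroup n →* unitaryGroup (Fin r) ℂ from ρ) x

theorem Rep.val_pow (ρ : Rep n r) (x : LinkGroup n) (j : ℕ) : ρ.val (x ^ j) = ρ.val x ^ j :=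
  map_pow (show LinkGroup n →* unitaryGroup (Fin r) ℂ from ρ) x j

theorem Rep.smul_val (g : unitaryGroup (Fin r) ℂ) (ρ : Rep n r) (γ : LinkGroup n) :
    (g • ρ).val γ = g * ρ.val γ * g⁻¹ := rfl

theorem Rep.commute_gen (ρ : Rep n r) : Commute (ρ.val (genA n) ^ n) (ρ.val (genB n)) := by
  have h : genA n ^ n * genB n * (genA n ^ n)⁻¹ * (genB n)⁻¹ = 1 :=
    PresentedGroup.one_of_mem (rels := linkRels n) rfl
  rw [mul_inv_eq_one, mul_inv_eq_iff_eq_mul] at h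
  have h' := congrArg (show LinkGroup n →* unitaryGroup (Fin r) ℂ from ρ) h
  change ρ.val _ = ρ.val _ at h'
  rwa [ρ.val_mul, ρ.val_mul, ρ.val_pow] at h'

/-- In finite dimension, a subspace invariant under a unitary matrix is invariant under its
inverse. -/
theorem inv_mulVec_mem {ι : Type*} [Fintype ι] [DecidableEq ι] (g : unitaryGroup ι ℂ)
    {W : Submodule ℂ (ι → ℂ)} (hW : ∀ v ∈ W, g.1 *ᵥ v ∈ W) : ∀ v ∈ W, (g⁻¹).1 *ᵥ v ∈ W := by
  have hle : W.map (unitaryEquiv g).toLinearMap ≤ W := by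
    rintro _ ⟨v, hv, rfl⟩
    exact hW v hv
  have heq : W.map (unitaryEquiv g).toLinearMap = W :=
    Submodule.eq_of_le_of_finrank_eq hle (LinearEquiv.finrank_map_eq (unitaryEquiv g) W)
  intro v hv
  rw [← heq] at hv
  obtain ⟨w, hw, rfl⟩ := hv
  change (g⁻¹).1 *ᵥ g.1 *ᵥ w ∈ W
  rwa [mulVec_mulVec, ← Submonoid.coe_mul, inv_mul_cancel, Submonoid.coe_one, one_mulVec]

/-- Irreducibility can be tested on the generators. -/
theorem Rep.isIrreducible_iff (ρ : Rep n r) : ρ.IsIrreducible ↔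
    ActsIrreducibly {(ρ.val (genA n)).1, (ρ.val (genB n)).1} := by
  constructor
  · intro h W hW
    refine h W ?_
    have hAB : ∀ i, ∀ v ∈ W, (ρ.val (PresentedGroup.of i)).1 *ᵥ v ∈ W := by
      intro i
      fin_cases i
      · exact hW _ (Or.inl rfl)
      · exact hW _ (Or.inr rfl)
    rintro _ ⟨γ, rfl⟩
    have hγ : γ ∈ Subgroup.closure (Set.range (PresentedGroup.of (rels := linkRels n))) := by
      rw [PresentedGroup.closure_range_of]
      exact Subgroup.mem_top γ
    induction hγ using Subgroup.closure_induction with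
    | mem x hx =>
      obtain ⟨i, rfl⟩ := hx
      exact hAB i
    | one =>
      intro v hv
      simpa [ρ.val_one] using hv
    | mul x y _ _ hx hy =>
      intro v hv
      change (ρ.val (x * y)).1 *ᵥ v ∈ W
      rw [ρ.val_mul, Submonoid.coe_mul, ← mulVec_mulVec]
      exact hx _ (hy v hv)
    | inv x _ hx =>
      change ∀ v ∈ W, (ρ.val x⁻¹).1 *ᵥ v ∈ W
      rw [ρ.val_inv]
      exact inv_mulVec_mem _ hx
  · intro h W hW
    refine h W ?_
    rintro M (rfl | rfl)
    · exact hW _ ⟨_, rfl⟩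
    · exact hW _ ⟨_, rfl⟩

theorem actsIrreducibly_conj {ι : Type*} [Fintype ι] [DecidableEq ι]
    (g A B : unitaryGroup ι ℂ) (h : ActsIrreducibly {A.1, B.1}) :
    ActsIrreducibly {(g * A * g⁻¹).1, (g * B * g⁻¹).1} := by
  have key : ∀ (M : unitaryGroup ι ℂ) (v : ι → ℂ),
      unitaryEquiv g (M.1 *ᵥ v) = (g * M * g⁻¹).1 *ᵥ unitaryEquiv g v := fun M v => by
    change g.1 *ᵥ M.1 *ᵥ v = (g * M * g⁻¹).1 *ᵥ g.1 *ᵥ v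
    rw [mulVec_mulVec, mulVec_mulVec, ← Submonoid.coe_mul, ← Submonoid.coe_mul,
      inv_mul_cancel_right]
  refine h.transport (unitaryEquiv g) ?_
  rintro M (rfl | rfl)
  · exact ⟨_, Or.inl rfl, key A⟩
  · exact ⟨_, Or.inr rfl, key B⟩

theorem Rep.IsIrreducible.smul {ρ : Rep n r} (h : ρ.IsIrreducible) (g : unitaryGroup (Fin r) ℂ) :
    (g • ρ).IsIrreducible :=
  (g • ρ).isIrreducible_iff.2 (actsIrreducibly_conj g _ _ (ρ.isIrreducible_iff.1 h))

theorem mk_eq_mk_iff {ρ ρ' : Rep n r} :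
    (⟦ρ⟧ : CharVar n r) = ⟦ρ'⟧ ↔ ∃ g : unitaryGroup (Fin r) ℂ, g • ρ = ρ' := by
  rw [eq_comm, Quotient.eq]
  exact Iff.rfl

theorem Rep.isIrreducible_congr {ρ ρ' : Rep n r} (h : (⟦ρ⟧ : CharVar n r) = ⟦ρ'⟧) :
    ρ.IsIrreducible ↔ ρ'.IsIrreducible := by
  obtain ⟨g, rfl⟩ := mk_eq_mk_iff.1 h
  refine ⟨fun h => h.smul g, fun h => ?_⟩
  have := h.smul g⁻¹
  rwa [inv_smul_smul] at this

end Representations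

section Reindex

variable {ι κ : Type*} [Fintype ι] [DecidableEq ι] [Fintype κ] [DecidableEq κ]

theorem ureindex_injective (e : ι ≃ κ) : Function.Injective (ureindex e) := fun _ _ h =>
  Subtype.ext ((reindex e e).injective (congrArg Subtype.val h))

theorem ureindex_surjective (e : ι ≃ κ) : Function.Surjective (ureindex e) := fun B =>
  ⟨ureindex e.symm B, Subtype.ext ((reindex e e).apply_symm_apply B.1)⟩

theorem actsIrreducibly_ureindex_iff (e : ι ≃ κ) (A B : unitaryGroup ι ℂ) :
    ActsIrreducibly {(ureindex e A).1, (ureindex e B).1} ↔ ActsIrreducibly {A.1, B.1} := by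
  have key : ∀ (M : unitaryGroup ι ℂ) (v : ι → ℂ),
      LinearEquiv.funCongrLeft ℂ ℂ e.symm (M.1 *ᵥ v) =
        (ureindex e M).1 *ᵥ LinearEquiv.funCongrLeft ℂ ℂ e.symm v := fun M v => by
    change (M.1 *ᵥ v) ∘ e.symm = (M.1.submatrix e.symm e.symm) *ᵥ (v ∘ e.symm)
    rw [submatrix_mulVec_equiv]
    congr 2
    funext x
    simp
  constructor
  · intro h
    refine h.transport (LinearEquiv.funCongrLeft ℂ ℂ e.symm).symm ?_
    rintro M (rfl | rfl)
    · exact ⟨_, Or.inl rfl, fun v => by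
        rw [LinearEquiv.symm_apply_eq, key, LinearEquiv.apply_symm_apply]⟩
    · exact ⟨_, Or.inr rfl, fun v => by
        rw [LinearEquiv.symm_apply_eq, key, LinearEquiv.apply_symm_apply]⟩
  · intro h
    refine h.transport (LinearEquiv.funCongrLeft ℂ ℂ e.symm) ?_
    rintro M (rfl | rfl)
    · exact ⟨_, Or.inl rfl, key A⟩
    · exact ⟨_, Or.inr rfl, key B⟩

end Reindex

/-! ### Representations in block form and their conjugacy classes -/

section Model

variable {n r N : ℕ} {m : Fin N → ℕ}

/-- Irreducibility together with one block scalar matrix with distinct eigenvalues is enough. -/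
theorem isFibre_of_actsIrreducibly {l : Fin N → Circle} {B : unitaryGroup (BlockIndex m) ℂ}
    (h : ActsIrreducibly {(blockDiag m l).1, B.1}) : IsFibre m B := by
  intro l' hl' W hW
  refine h W ?_
  rintro M (rfl | rfl)
  · exact invariant_blockDiag hl' (hW _ (Or.inl rfl)) l
  · exact hW _ (Or.inr rfl)

theorem commute_blockDiag_pow {l : Fin N → Circle} (hl : ∀ i j, l i ^ n = l j ^ n)
    (B : unitaryGroup (BlockIndex m) ℂ) : Commute (blockDiag m l ^ n) B := by
  rw [← map_pow]
  apply Subtype.ext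
  change diagonal _ * B.1 = B.1 * diagonal _
  ext x y
  rw [diagonal_mul, mul_diagonal, mul_comm]
  change B.1 x y * ((l x.1 ^ n : Circle) : ℂ) = B.1 x y * ((l y.1 ^ n : Circle) : ℂ)
  rw [hl]

/-- Schur's lemma for the central element `a ^ n`: its eigenvalues all agree. -/
theorem pow_eq_pow_of_actsIrreducibly (hm : ∀ i, 0 < m i) {l : Fin N → Circle}
    {B : unitaryGroup (BlockIndex m) ℂ} (h : ActsIrreducibly {(blockDiag m l).1, B.1})
    (hcomm : Commute (blockDiag m l ^ n) B) (i j : Fin N) : l i ^ n = l j ^ n := by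
  rw [← map_pow] at hcomm
  -- The eigenspace of `a ^ n` is invariant, and not zero, hence everything.
  let W : Submodule ℂ (BlockIndex m → ℂ) :=
    LinearMap.ker (mulVecLin ((blockDiag m (l ^ n)).1 - scalar _ ((l i ^ n : Circle) : ℂ)))
  have hmem : ∀ v, v ∈ W ↔ ∀ x : BlockIndex m,
      ((l x.1 ^ n : Circle) : ℂ) * v x = ((l i ^ n : Circle) : ℂ) * v x := by
    intro v
    rw [LinearMap.mem_ker, mulVecLin_apply, sub_mulVec, sub_eq_zero, funext_iff]
    refine forall_congr' fun x => ?_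
    change (diagonal _ *ᵥ v) x = (diagonal _ *ᵥ v) x ↔ _
    rw [mulVec_diagonal, mulVec_diagonal]
    rfl
  have hW : W = ⊥ ∨ W = ⊤ := by
    have hinv : ∀ M : unitaryGroup (BlockIndex m) ℂ, Commute (blockDiag m (l ^ n)) M →
        ∀ v ∈ W, M.1 *ᵥ v ∈ W := by
      intro M hM v hv
      rw [LinearMap.mem_ker, mulVecLin_apply] at hv ⊢
      have h1 : Commute ((blockDiag m (l ^ n)).1 - scalar _ ((l i ^ n : Circle) : ℂ)) M.1 :=
        Commute.sub_left (congrArg Subtype.val hM.eq) (scalar_commute _ (fun _ => Commute.all _ _) _)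
      rw [mulVec_mulVec, h1.eq, ← mulVec_mulVec, hv, mulVec_zero]
    refine h W ?_
    rintro M (rfl | rfl)
    · refine hinv _ ?_
      rw [map_pow]
      exact Commute.pow_self _ _
    · exact hinv _ hcomm
  rcases hW with hW | hW
  · exfalso
    have h1 : (Pi.single ⟨i, ⟨0, hm i⟩⟩ 1 : BlockIndex m → ℂ) ∈ W := by
      rw [hmem]
      intro x
      by_cases hx : x = ⟨i, ⟨0, hm i⟩⟩
      · rw [hx]
      · rw [Pi.single_eq_of_ne hx, mul_zero, mul_zero]
    rw [hW, Submodule.mem_bot] at h1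
    simpa using congrFun h1 ⟨i, ⟨0, hm i⟩⟩
  · have h1 : (fun _ => 1 : BlockIndex m → ℂ) ∈ W := hW ▸ Submodule.mem_top
    have h2 := (hmem _).1 h1 ⟨j, ⟨0, hm j⟩⟩
    rw [mul_one, mul_one] at h2
    exact (Circle.coe_injective h2).symm

/-- The representation `a ↦ A_l`, `b ↦ B`, in coordinates numbered by `Fin r`. -/
def modelRep (h : ∑ i, m i = r) (l : EigenTuple n N) (B : unitaryGroup (BlockIndex m) ℂ) :
    Rep n r :=
  repOfPair (ureindex (blockEquiv m h) (blockDiag m l.1)) (ureindex (blockEquiv m h) B) (by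
    rw [← map_pow]
    exact (commute_blockDiag_pow l.2.2 B).map (ureindex (blockEquiv m h)))

theorem modelRep_genA (h : ∑ i, m i = r) (l : EigenTuple n N)
    (B : unitaryGroup (BlockIndex m) ℂ) :
    (modelRep h l B).val (genA n) = ureindex (blockEquiv m h) (blockDiag m l.1) :=
  repOfPair_genA _ _ _

theorem modelRep_genB (h : ∑ i, m i = r) (l : EigenTuple n N)
    (B : unitaryGroup (BlockIndex m) ℂ) :
    (modelRep h l B).val (genB n) = ureindex (blockEquiv m h) B :=
  repOfPair_genB _ _ _

theorem modelRep_isIrreducible_iff (h : ∑ i, m i = r) (l : EigenTuple n N)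
    (B : unitaryGroup (BlockIndex m) ℂ) : (modelRep h l B).IsIrreducible ↔ IsFibre m B := by
  rw [Rep.isIrreducible_iff, modelRep_genA, modelRep_genB, actsIrreducibly_ureindex_iff]
  exact ⟨isFibre_of_actsIrreducibly, fun hB => hB l.1 l.2.1⟩

theorem mk_modelRep_eq_iff (h : ∑ i, m i = r) {l l' : EigenTuple n N}
    {B B' : unitaryGroup (BlockIndex m) ℂ} :
    (⟦modelRep h l B⟧ : CharVar n r) = ⟦modelRep h l' B'⟧ ↔
      ∃ g, g * blockDiag m l.1 * g⁻¹ = blockDiag m l'.1 ∧ g * B * g⁻¹ = B' := by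
  rw [mk_eq_mk_iff]
  constructor
  · rintro ⟨g, hg⟩
    obtain ⟨g, rfl⟩ := ureindex_surjective (blockEquiv m h) g
    refine ⟨g, ureindex_injective (blockEquiv m h) ?_, ureindex_injective (blockEquiv m h) ?_⟩
    · rw [← modelRep_genA h l' B', ← hg, Rep.smul_val, modelRep_genA]
      simp only [map_mul, map_inv]
    · rw [← modelRep_genB h l' B', ← hg, Rep.smul_val, modelRep_genB]
      simp only [map_mul, map_inv]
  · rintro ⟨g, hA, hB⟩
    refine ⟨ureindex (blockEquiv m h) g, Rep.ext_gen ?_ ?_⟩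
    · rw [Rep.smul_val, modelRep_genA, modelRep_genA, ← hA]
      simp only [map_mul, map_inv]
    · rw [Rep.smul_val, modelRep_genB, modelRep_genB, ← hB]
      simp only [map_mul, map_inv]

/-- The eigenvalues of conjugate matrices in block form differ by a permutation that preserves
the multiplicities. -/
theorem exists_multPerm_of_charpoly_eq (hm : ∀ i, 0 < m i) {l l' : Fin N → Circle}
    (hl : Function.Injective l) (hl' : Function.Injective l')
    (h : (blockDiag m l).1.charpoly = (blockDiag m l').1.charpoly) :
    ∃ t : multPerm m, ∀ i, l' (t.1 i) = l i := by
  have hex : ∀ i, ∃ j, l' j = l i := fun i => by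
    have h1 : (l i : ℂ) ∈ (blockDiag m l').1.charpoly.roots := by
      rw [← h, roots_charpoly_blockDiag]
      exact ⟨i, hm i, rfl⟩
    obtain ⟨j, _, hj⟩ := (roots_charpoly_blockDiag _ _).1 h1
    exact ⟨j, Circle.coe_injective hj⟩
  choose f hf using hex
  have hfinj : Function.Injective f := fun i j hij => hl (by rw [← hf, ← hf, hij])
  refine ⟨⟨Equiv.ofBijective f (Finite.injective_iff_bijective.1 hfinj), fun i => ?_⟩, hf⟩
  change m (f i) = m i
  rw [← count_roots_charpoly_blockDiag (m := m) hl' (f i), hf, ← h,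
    count_roots_charpoly_blockDiag hl]

/-- The centraliser of a block scalar matrix with distinct eigenvalues is block diagonal. -/
theorem mem_blockStab_of_commute {l : Fin N → Circle} (hl : Function.Injective l)
    {g : unitaryGroup (BlockIndex m) ℂ} (h : g * blockDiag m l = blockDiag m l * g) :
    g ∈ blockStab m := by
  intro x y hxy
  have h1 : g.1 * diagonal _ = diagonal _ * g.1 := congrArg Subtype.val h
  have h2 := congrFun (congrFun h1 x) y
  rw [mul_diagonal, diagonal_mul, mul_comm, ← sub_eq_zero, ← sub_mul] at h2
  refine (mul_eq_zero.1 h2).resolve_left fun h3 => hxy ?_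
  exact (hl (Circle.coe_injective (sub_eq_zero.1 h3))).symm

theorem EigenTuple.smul_val (t : multPerm m) (l : EigenTuple n N) (i : Fin N) :
    (t • l).1 i = l.1 (t.1⁻¹ i) := rfl

theorem permConj_blockDiag_eq_smul (t : multPerm m) (l : EigenTuple n N) :
    permConj t (blockDiag m l.1) = blockDiag m (t • l).1 :=
  permConj_blockDiag t l.1

/-- Two representations in block form are conjugate exactly when the data defining them agree up
to a permutation of the blocks and conjugation by the stabiliser. -/
theorem mk_modelRep_eq_iff_exists_perm (hm : ∀ i, 0 < m i) (h : ∑ i, m i = r)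
    {l l' : EigenTuple n N} {B B' : unitaryGroup (BlockIndex m) ℂ} :
    (⟦modelRep h l B⟧ : CharVar n r) = ⟦modelRep h l' B'⟧ ↔
      ∃ t : multPerm m, t • l = l' ∧ ∃ g ∈ blockStab m, g * permConj t B * g⁻¹ = B' := by
  rw [mk_modelRep_eq_iff]
  constructor
  · rintro ⟨g, hA, hB⟩
    obtain ⟨t, ht⟩ := exists_multPerm_of_charpoly_eq hm l.2.1 l'.2.1
      (by rw [← hA, charpoly_conj])
    obtain ⟨P, hP⟩ := exists_conj_ureindex (liftPerm m t)
    have htl : t • l = l' := Subtype.ext (funext fun i => by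
      rw [EigenTuple.smul_val, ← ht]
      simp)
    -- `g` differs from the permutation matrix by an element of the centraliser of `A_(l')`.
    refine ⟨t, htl, g * P⁻¹, mem_blockStab_of_commute l'.2.1 ?_, ?_⟩
    · have h1 : P * blockDiag m l.1 * P⁻¹ = blockDiag m l'.1 := by
        rw [hP, ← htl]
        exact permConj_blockDiag t l.1
      calc g * P⁻¹ * blockDiag m l'.1 = g * blockDiag m l.1 * g⁻¹ * (g * P⁻¹) := by
            rw [← h1]
            group
        _ = blockDiag m l'.1 * (g * P⁻¹) := by rw [hA]
    · rw [permConj, ← hP, ← hB]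
      group
  · rintro ⟨t, rfl, g, hg, rfl⟩
    obtain ⟨P, hP⟩ := exists_conj_ureindex (liftPerm m t)
    refine ⟨g * P, ?_, ?_⟩
    · rw [show g * P * blockDiag m l.1 * (g * P)⁻¹ = g * (P * blockDiag m l.1 * P⁻¹) * g⁻¹ by group,
        hP, mul_inv_eq_iff_eq_mul]
      change g * permConj t (blockDiag m l.1) = _
      rw [permConj_blockDiag_eq_smul, blockStab_comm hg]
    · rw [permConj, ← hP]
      group

theorem pos_of_parts {σ : r.Partition} (hσ : σ.parts = Finset.univ.val.map m) (i : Fin N) :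
    0 < m i :=
  σ.parts_pos (hσ ▸ Multiset.mem_map_of_mem m (Finset.mem_univ i))

/-- Representations in block form have the right multiplicities, so only irreducibility decides
whether their classes are in the stratum. -/
theorem mk_modelRep_mem_stratum_iff {σ : r.Partition} (hσ : σ.parts = Finset.univ.val.map m)
    (l : EigenTuple n N) (B : unitaryGroup (BlockIndex m) ℂ) :
    (⟦modelRep (sum_of_parts hσ) l B⟧ : CharVar n r) ∈ Stratum n σ ↔ IsFibre m B := by
  rw [← modelRep_isIrreducible_iff (sum_of_parts hσ) l B]
  constructor
  · rintro ⟨ρ, hρ, hirr, -⟩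
    exact (Rep.isIrreducible_congr hρ).1 hirr
  · intro h
    refine ⟨_, rfl, h, ?_⟩
    rw [hσ]
    refine eigenMultiplicities_eq l.2.1 (pos_of_parts hσ) ?_
    rw [modelRep_genA, charpoly_ureindex]

/-- Every class in the stratum contains a representation in block form. -/
theorem exists_modelRep_of_mem_stratum {σ : r.Partition}
    (hσ : σ.parts = Finset.univ.val.map m) {x : CharVar n r} (hx : x ∈ Stratum n σ) :
    ∃ (l : EigenTuple n N) (B : unitaryGroup (BlockIndex m) ℂ),
      (⟦modelRep (sum_of_parts hσ) l B⟧ : CharVar n r) = x := by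
  obtain ⟨ρ, rfl, hirr, hmult⟩ := hx
  obtain ⟨g, l, hl, hA⟩ := exists_conj_blockDiag (sum_of_parts hσ) _ (hmult.trans hσ)
  obtain ⟨B, hB⟩ := ureindex_surjective (blockEquiv m (sum_of_parts hσ))
    (g⁻¹ * ρ.val (genB n) * g)
  have hA' : (g⁻¹ • ρ).val (genA n) =
      ureindex (blockEquiv m (sum_of_parts hσ)) (blockDiag m l) := by
    rw [Rep.smul_val, hA]
    group
  have hB' : (g⁻¹ • ρ).val (genB n) = ureindex (blockEquiv m (sum_of_parts hσ)) B := by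
    rw [Rep.smul_val, hB, inv_inv]
  have hirr' := (g⁻¹ • ρ).isIrreducible_iff.1 (hirr.smul g⁻¹)
  rw [hA', hB', actsIrreducibly_ureindex_iff] at hirr'
  have hcomm := (g⁻¹ • ρ).commute_gen
  rw [hA', hB', ← map_pow] at hcomm
  have hcomm' : Commute (blockDiag m l ^ n) B := by
    apply ureindex_injective (blockEquiv m (sum_of_parts hσ))
    rw [map_mul, map_mul]
    exact hcomm
  let l' : EigenTuple n N :=
    ⟨l, hl, pow_eq_pow_of_actsIrreducibly (pos_of_parts hσ) hirr' hcomm'⟩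
  refine ⟨l', B, ?_⟩
  rw [mk_eq_mk_iff]
  refine ⟨g, ?_⟩
  rw [← eq_inv_smul_iff]
  refine Rep.ext_gen ?_ ?_
  · exact (modelRep_genA _ l' B).trans hA'.symm
  · exact (modelRep_genB _ l' B).trans hB'.symm

end Model

/-! ### The stratum as a topological quotient -/

section Topology

open Topology

/-- Two quotient maps on the same space with the same fibres have homeomorphic targets. -/
theorem _root_.Topology.IsQuotientMap.exists_homeomorph {X Y Z : Type*} [TopologicalSpace X]
    [TopologicalSpace Y] [TopologicalSpace Z] {f : X → Y} {g : X → Z} (hf : IsQuotientMap f)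
    (hg : IsQuotientMap g) (h : ∀ x y, f x = f y ↔ g x = g y) :
    ∃ Φ : Y ≃ₜ Z, ∀ x, Φ (f x) = g x := by
  let φ : Y → Z := fun y => g (Function.surjInv hf.surjective y)
  have hφ : ∀ x, φ (f x) = g x := fun x => (h _ _).1 (Function.surjInv_eq hf.surjective (f x))
  have hcomp : φ ∘ f = g := funext hφ
  have hcont : Continuous φ := hf.continuous_iff.2 (hcomp ▸ hg.continuous)
  have hquot : IsQuotientMap φ := IsQuotientMap.of_comp hf.continuous hcont (hcomp ▸ hg)
  have hinj : Function.Injective φ := by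
    intro y y' hy
    obtain ⟨x, rfl⟩ := hf.surjective y
    obtain ⟨x', rfl⟩ := hf.surjective y'
    rw [hφ, hφ] at hy
    exact (h x x').2 hy
  exact ⟨(isHomeomorph_iff_isQuotientMap_injective.2 ⟨hquot, hinj⟩).homeomorph φ, hφ⟩

instance {ι : Type*} [Fintype ι] [DecidableEq ι] : CompactSpace (unitaryGroup ι ℂ) := by
  refine isCompact_iff_compactSpace.1 (IsCompact.of_isClosed_subset
    (s := Set.univ.pi fun _ => Set.univ.pi fun _ => Metric.closedBall (0 : ℂ) 1)
    (isCompact_univ_pi fun _ => isCompact_univ_pi fun _ => isCompact_closedBall _ _) ?_ ?_)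
  · have : ((unitaryGroup ι ℂ : Submonoid (Matrix ι ι ℂ)) : Set (Matrix ι ι ℂ)) =
        {A | A * star A = 1} := Set.ext fun A => mem_unitaryGroup_iff
    rw [this]
    exact isClosed_eq (by fun_prop) continuous_const
  · intro A hA i _ j _
    rw [mem_closedBall_zero_iff]
    exact entry_norm_bound_of_unitary hA i j

theorem continuous_ureindex {ι κ : Type*} [Fintype ι] [DecidableEq ι] [Fintype κ] [DecidableEq κ]
    (e : ι ≃ κ) : Continuous (ureindex e) :=
  (continuous_subtype_val.matrix_reindex e e).subtype_mk _

theorem continuous_blockDiag {N : ℕ} (m : Fin N → ℕ) : Continuous (blockDiag m) := by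
  refine Continuous.subtype_mk (Continuous.matrix_diagonal ?_) _
  exact continuous_pi fun x => continuous_subtype_val.comp (continuous_apply x.1)

variable {n r : ℕ}

theorem continuous_rep_iff {X : Type*} [TopologicalSpace X] {f : X → Rep n r} :
    Continuous f ↔ Continuous (fun x => (f x).val (genA n)) ∧
      Continuous fun x => (f x).val (genB n) :=
  continuous_induced_rng.trans continuous_prodMk

theorem Rep.continuous_val_genA : Continuous fun ρ : Rep n r => ρ.val (genA n) :=
  (continuous_rep_iff.1 continuous_id).1

theorem Rep.continuous_val_genB : Continuous fun ρ : Rep n r => ρ.val (genB n) :=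
  (continuous_rep_iff.1 continuous_id).2

instance : T2Space (Rep n r) :=
  Topology.IsEmbedding.t2Space (f := fun ρ : Rep n r => (ρ.val (genA n), ρ.val (genB n)))
    ⟨⟨rfl⟩, fun _ _ h => Rep.ext_gen (congrArg Prod.fst h) (congrArg Prod.snd h)⟩

instance : ContinuousSMul (unitaryGroup (Fin r) ℂ) (Rep n r) := by
  refine ⟨continuous_rep_iff.2 ⟨?_, ?_⟩⟩
  · exact (continuous_fst.mul (Rep.continuous_val_genA.comp continuous_snd)).mul continuous_fst.inv
  · exact (continuous_fst.mul (Rep.continuous_val_genB.comp continuous_snd)).mul continuous_fst.inv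

section

variable {N : ℕ} {m : Fin N → ℕ}

instance : ContinuousConstSMul (blockStab m) (Fibre0 m) where
  continuous_const_smul g :=
    ((continuous_const.mul continuous_subtype_val).mul continuous_const).subtype_mk
      fun B : Fibre0 m => (g • B).2

instance : ContinuousConstSMul (blockStab m) (SFibre0 m) where
  continuous_const_smul g :=
    ((continuous_const.mul continuous_subtype_val).mul continuous_const).subtype_mk
      fun B : SFibre0 m => (g • B).2

theorem continuous_modelRep (h : ∑ i, m i = r) :
    Continuous fun p : EigenTuple n N × unitaryGroup (BlockIndex m) ℂ => modelRep h p.1 p.2 := by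
  refine continuous_rep_iff.2 ⟨?_, ?_⟩
  · simp only [modelRep_genA]
    exact (continuous_ureindex _).comp ((continuous_blockDiag m).comp
      (continuous_subtype_val.comp continuous_fst))
  · simp only [modelRep_genB]
    exact (continuous_ureindex _).comp continuous_snd

/-- Compactness of `U(r)` makes the classes of a closed set of representations in block form
a closed set. -/
theorem isClosedMap_mk_modelRep [CompactSpace (EigenTuple n N)] (h : ∑ i, m i = r) :
    IsClosedMap fun p : EigenTuple n N × unitaryGroup (BlockIndex m) ℂ =>
      (⟦modelRep h p.1 p.2⟧ : CharVar n r) := by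
  intro S hS
  let F : unitaryGroup (Fin r) ℂ × (EigenTuple n N × unitaryGroup (BlockIndex m) ℂ) → Rep n r :=
    fun x => x.1 • modelRep h x.2.1 x.2.2
  have hF : Continuous F := continuous_fst.smul ((continuous_modelRep h).comp continuous_snd)
  -- The saturation of the set of representations is the image of a compact set.
  have himg : IsClosed (F '' (Set.univ ×ˢ S)) := hF.isClosedMap _ (isClosed_univ.prod hS)
  rw [← isQuotientMap_quotient_mk'.isClosed_preimage]
  convert himg using 1
  ext ρ
  constructor
  · rintro ⟨p, hp, hρ⟩
    obtain ⟨g, hg⟩ := mk_eq_mk_iff.1 hρ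
    exact ⟨(g, p), ⟨trivial, hp⟩, hg⟩
  · rintro ⟨⟨g, p⟩, ⟨-, hp⟩, rfl⟩
    exact ⟨p, hp, mk_eq_mk_iff.2 ⟨g, rfl⟩⟩

/-- The class of a representation in block form, as a point of the stratum. -/
def modelClass {σ : r.Partition} (hσ : σ.parts = Finset.univ.val.map m)
    (p : EigenTuple n N × Fibre0 m) : Stratum n σ :=
  ⟨⟦modelRep (sum_of_parts hσ) p.1 p.2.1⟧, (mk_modelRep_mem_stratum_iff hσ p.1 p.2.1).2 p.2.2⟩

/-- The parametrisation of the stratum is the restriction of a closed map to a full preimage,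
hence closed. -/
theorem isQuotientMap_modelClass [CompactSpace (EigenTuple n N)] {σ : r.Partition}
    (hσ : σ.parts = Finset.univ.val.map m) : IsQuotientMap (modelClass (n := n) hσ) := by
  have hj : IsInducing (Prod.map id Subtype.val :
      EigenTuple n N × Fibre0 m → EigenTuple n N × unitaryGroup (BlockIndex m) ℂ) :=
    IsInducing.id.prodMap IsInducing.subtypeVal
  refine IsClosedMap.isQuotientMap ?_ ?_ ?_
  · intro S hS
    obtain ⟨T, hT, rfl⟩ := hj.isClosed_iff.1 hS
    refine ⟨_, isClosedMap_mk_modelRep (sum_of_parts hσ) T hT, ?_⟩ |> isClosed_induced_iff.2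
    ext ⟨x, hx⟩
    constructor
    · rintro ⟨⟨l, B⟩, hp, rfl⟩
      exact ⟨⟨l, ⟨B, (mk_modelRep_mem_stratum_iff hσ l B).1 hx⟩⟩, hp, rfl⟩
    · rintro ⟨p, hp, hx⟩
      exact ⟨_, hp, congrArg Subtype.val hx⟩
  · exact (continuous_quotient_mk'.comp ((continuous_modelRep _).comp hj.continuous)).subtype_mk _
  · rintro ⟨x, hx⟩
    obtain ⟨l, B, rfl⟩ := exists_modelRep_of_mem_stratum hσ hx
    exact ⟨⟨l, ⟨B, (mk_modelRep_mem_stratum_iff hσ l B).1 hx⟩⟩, rfl⟩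

/-- The class in `(Σ_σ × F_σ) / S_σ` of a tuple and a matrix. -/
def eigenFibreMk (n : ℕ) (m : Fin N → ℕ) (p : EigenTuple n N × Fibre0 m) :
    EigenFibreQuotient n m :=
  ⟦(p.1, ⟦p.2⟧)⟧

theorem isQuotientMap_eigenFibreMk : IsQuotientMap (eigenFibreMk n m) :=
  isQuotientMap_quotient_mk'.comp
    (IsOpenQuotientMap.id.prodMap MulAction.isOpenQuotientMap_quotientMk).isQuotientMap

theorem eigenFibreMk_eq_iff {p q : EigenTuple n N × Fibre0 m} :
    eigenFibreMk n m p = eigenFibreMk n m q ↔ ∃ t : multPerm m, t • p.1 = q.1 ∧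
      ∃ g ∈ blockStab m, g * permConj t p.2.1 * g⁻¹ = q.2.1 := by
  rw [eq_comm, eigenFibreMk, eigenFibreMk, Quotient.eq]
  constructor
  · rintro ⟨t, ht⟩
    obtain ⟨g, hg⟩ := Quotient.exact (congrArg Prod.snd ht).symm
    exact ⟨t, congrArg Prod.fst ht, g.1, g.2, congrArg Subtype.val hg⟩
  · rintro ⟨t, ht, g, hg, h⟩
    have hB : t • (⟦p.2⟧ : Fibre m) = ⟦q.2⟧ :=
      (Quotient.sound (s := MulAction.orbitRel (blockStab m) (Fibre0 m)) (a := q.2)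
        (b := ⟨permConj t p.2.1, p.2.2.perm t⟩) ⟨⟨g, hg⟩, Subtype.ext h⟩).symm
    exact ⟨t, Prod.ext ht hB⟩

theorem eigenFibreMk_eq_iff_modelClass {σ : r.Partition}
    (hσ : σ.parts = Finset.univ.val.map m) (p q : EigenTuple n N × Fibre0 m) :
    eigenFibreMk n m p = eigenFibreMk n m q ↔ modelClass hσ p = modelClass hσ q := by
  rw [eigenFibreMk_eq_iff, modelClass, modelClass, Subtype.mk_eq_mk,
    mk_modelRep_eq_iff_exists_perm (pos_of_parts hσ)]

end

/-! ### Coordinates on the eigenvalues and on the fibre -/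

section Parameters

variable {k : ℕ} {m : Fin (k + 1) → ℕ}

/-- The identification of `S¹ × Δ^k_{μ_n}` with `Σ_σ`. -/
def eigenParamHomeomorph (n k : ℕ) : EigenParam n k ≃ₜ EigenTuple n (k + 1) where
  toFun p := ⟨p.tuple, fun _ _ h => p.2.full_injective (mul_left_cancel h), fun i j => by
    simp only [EigenParam.tuple, mul_pow, RootTuple.full_pow]⟩
  invFun l := (l.1 0, ⟨fun i => l.1 i.succ / l.1 0,
    fun i : Fin k => ⟨by rw [div_pow, l.2.2 i.succ 0, div_self'], fun h =>
      Fin.succ_ne_zero i (l.2.1 (div_eq_one.1 h))⟩,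
    fun _ _ h => Fin.succ_injective _ (l.2.1 (div_left_injective h))⟩)
  left_inv p := by
    refine Prod.ext (mul_one p.1) (Subtype.ext (funext fun i => ?_))
    change p.1 * p.2.1 i / (p.1 * 1) = p.2.1 i
    rw [mul_one, mul_div_cancel_left]
  right_inv l := by
    refine Subtype.ext (funext fun i => Fin.cases ?_ (fun j => ?_) i)
    · exact mul_one _
    · exact mul_div_cancel _ _
  continuous_toFun := by
    refine Continuous.subtype_mk (continuous_pi fun i => ?_) _
    refine continuous_fst.mul (Fin.cases ?_ (fun j => ?_) i)
    · exact continuous_const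
    · exact (continuous_apply j).comp (continuous_subtype_val.comp continuous_snd)
  continuous_invFun := by
    have h : ∀ i, Continuous fun l : EigenTuple n (k + 1) => l.1 i := fun i =>
      (continuous_apply i).comp continuous_subtype_val
    exact (h 0).prodMk (Continuous.subtype_mk
      (continuous_pi fun i : Fin k => (h i.succ).div' (h 0)) _)

theorem eigenParamHomeomorph_smul (t : multPerm m) (p : EigenParam n k) :
    eigenParamHomeomorph n k (t • p) = t • eigenParamHomeomorph n k p :=
  Subtype.ext (EigenParam.perm_tuple t.1 p)

theorem finite_rootTuple (hn : 1 ≤ n) : Finite (RootTuple n k) := by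
  have hfin : Finite {z : Circle // z ^ n = 1} := by
    refine Finite.of_injective
      (fun z => (⟨(z.1 : ℂ), ?_⟩ : (Polynomial.nthRoots n (1 : ℂ)).toFinset)) ?_
    · rw [Multiset.mem_toFinset, Polynomial.mem_nthRoots hn, ← Circle.coe_pow, z.2, Circle.coe_one]
    · intro z w h
      exact Subtype.ext (Circle.coe_injective (Subtype.mk.inj h))
  refine Finite.of_injective
    (fun ε : RootTuple n k => fun i => (⟨ε.1 i, (ε.2.1 i).1⟩ : {z : Circle // z ^ n = 1})) ?_
  intro ε δ h
  exact Subtype.ext (funext fun i => congrArg Subtype.val (congrFun h i))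

/-- `Σ_σ` is a finite union of circles. -/
theorem compactSpace_eigenTuple (hn : 1 ≤ n) : CompactSpace (EigenTuple n (k + 1)) := by
  have := finite_rootTuple (k := k) hn
  have : CompactSpace (EigenParam n k) :=
    inferInstanceAs (CompactSpace (Circle × RootTuple n k))
  exact (eigenParamHomeomorph n k).compactSpace

theorem det_firstScale (hm : m 0 = 1) (u : Circle) : (firstScale m u).1.det = u := by
  change (diagonal fun x : BlockIndex m => (((if x.1 = 0 then u else 1 : Circle)) : ℂ)).det = u
  rw [det_diagonal, Fintype.prod_sigma, Fin.prod_univ_succ]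
  simp [hm]

theorem continuous_firstScale : Continuous (firstScale m) := by
  refine (continuous_blockDiag m).comp (continuous_pi fun i => ?_)
  split_ifs
  · exact continuous_id
  · exact continuous_const

/-- The determinant of a unitary matrix, as a point of the unit circle. -/
def udet {ι : Type*} [Fintype ι] [DecidableEq ι] (B : unitaryGroup ι ℂ) : Circle :=
  ⟨B.1.det, mem_sphere_zero_iff_norm.2 (CStarRing.norm_of_mem_unitary (det_of_mem_unitary B.2))⟩

theorem continuous_udet {ι : Type*} [Fintype ι] [DecidableEq ι] :
    Continuous (udet (ι := ι)) :=
  continuous_subtype_val.matrix_det.subtype_mk _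

theorem udet_mul_firstScale (hm : m 0 = 1) (B : SFibre0 m) (u : Circle) :
    udet (B.1 * firstScale m u) = u := by
  apply Circle.coe_injective
  change (B.1.1 * (firstScale m u).1).det = u
  rw [det_mul, B.2.2, one_mul, det_firstScale hm]

theorem det_mul_firstScale_udet_inv (hm : m 0 = 1) (B : unitaryGroup (BlockIndex m) ℂ) :
    (B * (firstScale m (udet B))⁻¹).1.det = 1 := by
  have h : (B * (firstScale m (udet B))⁻¹).1.det * (firstScale m (udet B)).1.det = B.1.det := by
    rw [← det_mul, ← Submonoid.coe_mul, inv_mul_cancel_right]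
  rw [det_firstScale hm] at h
  exact mul_right_cancel₀ (Circle.coe_ne_zero (udet B)) (h.trans (one_mul _).symm)

/-- If the first block has size one, every `B` is uniquely a matrix of determinant one with its
first column rescaled, namely by `det B`. -/
def fibreParamHomeomorph (hm : m 0 = 1) : SFibre0 m × Circle ≃ₜ Fibre0 m where
  toFun x := ⟨x.1.1 * firstScale m x.2, x.1.2.1.mul_blockDiag _⟩
  invFun B := (⟨B.1 * (firstScale m (udet B.1))⁻¹, by
    rw [firstScale, blockDiag_inv]
    exact B.2.mul_blockDiag _, det_mul_firstScale_udet_inv hm B.1⟩, udet B.1)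
  left_inv x := by
    refine Prod.ext (Subtype.ext ?_) (udet_mul_firstScale hm _ _)
    change x.1.1 * firstScale m x.2 * (firstScale m (udet (x.1.1 * firstScale m x.2)))⁻¹ = x.1.1
    rw [udet_mul_firstScale hm, mul_inv_cancel_right]
  right_inv B := Subtype.ext (inv_mul_cancel_right _ _)
  continuous_toFun := ((continuous_subtype_val.comp continuous_fst).mul
    (continuous_firstScale.comp continuous_snd)).subtype_mk _
  continuous_invFun := by
    have h : Continuous fun B : Fibre0 m => udet B.1 := continuous_udet.comp continuous_subtype_val
    exact (Continuous.subtype_mk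
      (continuous_subtype_val.mul (continuous_firstScale.comp h).inv) _).prodMk h

/-- The class in `(S¹ × Δ^k_{μ_n} × SF_σ × S¹) / S_σ` of given parameters. -/
def paramMk (n : ℕ) (m : Fin (k + 1) → ℕ) (p : EigenParam n k × (SFibre0 m × Circle)) :
    ParamQuotient n m :=
  ⟦(p.1, (⟦p.2.1⟧, p.2.2))⟧

theorem isQuotientMap_paramMk : IsQuotientMap (paramMk n m) :=
  isQuotientMap_quotient_mk'.comp (IsOpenQuotientMap.id.prodMap
    (MulAction.isOpenQuotientMap_quotientMk.prodMap IsOpenQuotientMap.id)).isQuotientMap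

theorem paramMk_eq_iff {p q : EigenParam n k × (SFibre0 m × Circle)} :
    paramMk n m p = paramMk n m q ↔ ∃ t : multPerm m, t • p.1 = q.1 ∧ p.2.2 = q.2.2 ∧
      ∃ g ∈ blockStab m, g * (SFibre0.perm t p.2.2 p.2.1).1 * g⁻¹ = q.2.1.1 := by
  rw [eq_comm, paramMk, paramMk, Quotient.eq]
  constructor
  · rintro ⟨t, ht⟩
    have h2 := congrArg Prod.snd ht
    obtain ⟨g, hg⟩ := Quotient.exact (congrArg (fun x : FibreParam m => x.1) h2).symm
    exact ⟨t, congrArg Prod.fst ht, congrArg (fun x : FibreParam m => x.2) h2,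
      g.1, g.2, congrArg Subtype.val hg⟩
  · rintro ⟨t, ht, hu, g, hg, h⟩
    exact ⟨t, Prod.ext ht (Prod.ext (Quotient.sound (s := MulAction.orbitRel (blockStab m) (SFibre0 m))
      ⟨⟨g, hg⟩, Subtype.ext h⟩).symm hu)⟩

theorem udet_conj_permConj (t : multPerm m) (g B : unitaryGroup (BlockIndex m) ℂ) :
    udet (g * permConj t B * g⁻¹) = udet B := by
  apply Circle.coe_injective
  change (g * permConj t B * g⁻¹).1.det = B.1.det
  rw [Submonoid.coe_mul, det_mul_comm, ← Submonoid.coe_mul, inv_mul_cancel_left, permConj_det]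

/-- The identifications of the parameter spaces are compatible with the group actions. -/
theorem paramMk_eq_iff_eigenFibreMk (hm : m 0 = 1)
    (p q : EigenParam n k × (SFibre0 m × Circle)) :
    paramMk n m p = paramMk n m q ↔
      eigenFibreMk n m ((eigenParamHomeomorph n k).prodCongr (fibreParamHomeomorph hm) p) =
        eigenFibreMk n m ((eigenParamHomeomorph n k).prodCongr (fibreParamHomeomorph hm) q) := by
  obtain ⟨p, B, u⟩ := p
  obtain ⟨q, B', u'⟩ := q
  rw [paramMk_eq_iff, eigenFibreMk_eq_iff]
  refine exists_congr fun t => and_congr ?_ ?_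
  · change t • p = q ↔ t • eigenParamHomeomorph n k p = eigenParamHomeomorph n k q
    rw [← eigenParamHomeomorph_smul, EmbeddingLike.apply_eq_iff_eq]
  · change (u = u' ∧ ∃ g ∈ blockStab m,
        g * (permConj t (B.1 * firstScale m u) * (firstScale m u)⁻¹) * g⁻¹ = B'.1) ↔
      ∃ g ∈ blockStab m, g * permConj t (B.1 * firstScale m u) * g⁻¹ = B'.1 * firstScale m u'
    have key : ∀ g ∈ blockStab m, ∀ C, g * (C * (firstScale m u)⁻¹) * g⁻¹ =
        g * C * g⁻¹ * (firstScale m u)⁻¹ := fun g hg C => by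
      have h1 : (firstScale m u)⁻¹ * g⁻¹ = g⁻¹ * (firstScale m u)⁻¹ := by
        rw [firstScale, blockDiag_inv]
        exact (blockStab_comm (inv_mem hg) _).symm
      simp only [mul_assoc, h1]
    constructor
    · rintro ⟨rfl, g, hg, h⟩
      refine ⟨g, hg, ?_⟩
      rw [← h, key g hg, inv_mul_cancel_right]
    · rintro ⟨g, hg, h⟩
      -- Conjugation preserves determinants, and these are the scaling factors.
      have hu : u = u' := by
        have h2 := congrArg udet h
        rwa [udet_conj_permConj, udet_mul_firstScale hm, udet_mul_firstScale hm] at h2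
      subst hu
      refine ⟨rfl, g, hg, ?_⟩
      rw [key g hg, h, mul_inv_cancel_right]

end Parameters

end Topology

end HopfLink

end

open HopfLink in
theorem mainTheorem7 (n r k : ℕ) (hn : 1 ≤ n) (σ : r.Partition) (m : Fin (k + 1) → ℕ)
    (hm : σ.parts = Finset.univ.val.map m) (hsimple : m 0 = 1) :
    ∃ (Φ : HopfLink.EigenFibreQuotient n m ≃ₜ HopfLink.Stratum n σ)
      (Ψ : HopfLink.ParamQuotient n m ≃ₜ HopfLink.Stratum n σ),
      (∀ (l : HopfLink.EigenTuple n (k + 1)) (B : HopfLink.Fibre0 m),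
        ∃ ρ : HopfLink.Rep n r,
          ρ.val (HopfLink.genA n) =
            HopfLink.ureindex (HopfLink.blockEquiv m (HopfLink.sum_of_parts hm))
              (HopfLink.blockDiag m l.1) ∧
          ρ.val (HopfLink.genB n) =
            HopfLink.ureindex (HopfLink.blockEquiv m (HopfLink.sum_of_parts hm)) B.1 ∧
          (Φ ⟦(l, ⟦B⟧)⟧ : HopfLink.CharVar n r) = ⟦ρ⟧) ∧
      (∀ (z : Circle) (ε : HopfLink.RootTuple n k) (B : HopfLink.SFibre0 m) (u : Circle),
        ∃ ρ : HopfLink.Rep n r,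
          ρ.val (HopfLink.genA n) =
            HopfLink.ureindex (HopfLink.blockEquiv m (HopfLink.sum_of_parts hm))
              (HopfLink.blockDiag m fun i => z * ε.full i) ∧
          ρ.val (HopfLink.genB n) =
            HopfLink.ureindex (HopfLink.blockEquiv m (HopfLink.sum_of_parts hm))
              (B.1 * HopfLink.firstScale m u) ∧
          (Ψ ⟦((z, ε), (⟦B⟧, u))⟧ : HopfLink.CharVar n r) = ⟦ρ⟧) := by
  have := compactSpace_eigenTuple (k := k) hn
  have hc := isQuotientMap_modelClass (n := n) hm
  let H := (eigenParamHomeomorph n k).prodCongr (fibreParamHomeomorph hsimple)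
  obtain ⟨Φ, hΦ⟩ := isQuotientMap_eigenFibreMk.exists_homeomorph hc
    (eigenFibreMk_eq_iff_modelClass hm)
  obtain ⟨Ψ, hΨ⟩ := isQuotientMap_paramMk.exists_homeomorph (hc.comp H.isQuotientMap) fun p q =>
    (paramMk_eq_iff_eigenFibreMk hsimple p q).trans (eigenFibreMk_eq_iff_modelClass hm _ _)
  refine ⟨Φ, Ψ, fun l B => ⟨_, modelRep_genA _ l B.1, modelRep_genB _ l B.1,
    congrArg Subtype.val (hΦ (l, B))⟩, fun z ε B u => ?_⟩
  exact ⟨_, modelRep_genA _ (eigenParamHomeomorph n k (z, ε)) _, modelRep_genB _ _ _,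
    congrArg Subtype.val (hΨ ((z, ε), (B, u)))⟩
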